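/- Let $\alpha,\beta,\mu\in\mathbb{C}$ and let $U\subset\mathbb{C}\setminus\{0,1\}$ be open. For $t\in U$ consider the modified Jacobi weight $$w(x,t)=x^{\alpha}(1-x)^{\beta}(x-t)^{\mu}$$ on a support that consists of finitely many smooth arcs. Each arc joins two of the points $0,1,t$ (not necessarily distinct), has non-zero velocity at its ends, meets none of these points in its interior, and depends smoothly on its own parameter and on $t$, and holomorphically on $t$. Along each arc the weight is given by a branch that is continuous along the arc and in $t$, up to a constant factor. The real parts of the exponents belonging to the end-points of the arcs ($\alpha$ at $0$, $\beta$ at $1$, $\mu$ at $t$) are larger than $-1$, so that all the moments $w_n=w_n(t)=\int x^n w(x,t)\,dx$, $n\ge 0$, exist. Let $f(x)=\sum_{n\ge 0}w_n/x^{n+1}$ be the Stieltjes function of $w$ (a formal series), put $\beta_0=w_1/w_0$ (the first recurrence coefficient of the monic orthogonal polynomials for $w$), and let $$\tilde f(x)=x-\beta_0-\frac{w_0}{f(x)}=\sum_{n\ge 0}\frac{\tilde w_n}{x^{n+1}}.$$ Let $\tilde P_n$ be the monic orthogonal polynomials for the moments $\tilde w_n$, and let $\tilde\beta_n=\tilde\beta_n(t)$,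 $\tilde\gamma_n=\tilde\gamma_n(t)$ be the coefficients in their recurrence relation $x\tilde P_n=\tilde P_{n+1}+\tilde\beta_n\tilde P_n+\tilde\gamma_n\tilde P_{n-1}$. Put $\nu_n=2n+5+\alpha+\beta+\mu$. Then at every $t\in U$ at which all the Hankel determinants $\Delta_k=\det[w_{i+j}]_{0\le i,j<k}$, $k\ge 0$, are non-zero, and for every $n\ge 1$, the functions $\tilde\beta_n$ and $\tilde\gamma_n$ are differentiable at $t$, $\tilde\gamma_n(t)\neq 0$, and $$t(t-1)\,\tilde\beta_n'=\tilde\beta_n(\tilde\beta_n-1)+(\nu_{n-1}+2)\,\tilde\gamma_{n+1}-(\nu_{n-1}-2)\,\tilde\gamma_n,$$ $$t(t-1)\,(\ln\tilde\gamma_n)'=-2+(\nu_{n-1}+1)\,\tilde\beta_n-(\nu_{n-1}-3)\,\tilde\beta_{n-1},$$ where $'$ is the derivative with respect to $t$ and $(\ln\tilde\gamma_n)'=\tilde\gamma_n'/\tilde\gamma_n$. -/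

import Mathlib

open Polynomial

noncomputable section

namespace LaguerreHahn

/-! ### Monic orthogonal polynomials of a moment sequence -/

/-- The moment functional of a sequence `w`: the linear form with `X ^ n ↦ w n`,
written `p ↦ ∫ p(x) w(x) dx` when `w n` are the moments of a weight. -/
def momentFunctional (w : ℕ → ℂ) (p : ℂ[X]) : ℂ :=
  p.sum fun i a => a * w i

/-- The Hankel determinant `Δ_n = det [w_{j+k}]`, `0 ≤ j, k < n` (so `Δ_0 = 1`). -/
def hankelDet (w : ℕ → ℂ) (n : ℕ) : ℂ :=
  (Matrix.of fun i j : Fin n => w ((i : ℕ) + (j : ℕ))).det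

/-- `P` is monic of degree `n` and orthogonal to all polynomials of degree less than `n`. -/
def IsMonicOP (w : ℕ → ℂ) (n : ℕ) (P : ℂ[X]) : Prop :=
  P.Monic ∧ P.natDegree = n ∧ ∀ m < n, momentFunctional w (X ^ m * P) = 0

/-- The monic orthogonal polynomial `P_n` of the moment sequence `w`
(it exists and is unique as soon as `Δ_n ≠ 0`). -/
def monicOP (w : ℕ → ℂ) (n : ℕ) : ℂ[X] :=
  Classical.epsilon (IsMonicOP w n)

/-- `h_n = ∫ P_n(x)² w(x) dx`. -/
def sqNorm (w : ℕ → ℂ) (n : ℕ) : ℂ :=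
  momentFunctional w (monicOP w n ^ 2)

/-- The recurrence coefficient `β_n = h_n⁻¹ ∫ x P_n(x)² w(x) dx` of
`x P_n = P_{n+1} + β_n P_n + γ_n P_{n-1}`. -/
def recBeta (w : ℕ → ℂ) (n : ℕ) : ℂ :=
  momentFunctional w (X * monicOP w n ^ 2) / sqNorm w n

/-- The recurrence coefficient `γ_n = h_{n-1}⁻¹ ∫ P_n(x)² w(x) dx`, for `n ≥ 1`, of
`x P_n = P_{n+1} + β_n P_n + γ_n P_{n-1}`. -/
def recGamma (w : ℕ → ℂ) (n : ℕ) : ℂ :=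
  sqNorm w n / sqNorm w (n - 1)

/-! ### The Stieltjes function and its Moebius transform

Formal series in `1/x` are Laurent series in the variable `z = 1/x`. -/

/-- The Stieltjes function `f = ∑ w_n / x^{n+1}`. -/
def stieltjes (w : ℕ → ℂ) : LaurentSeries ℂ :=
  HahnSeries.ofPowerSeries ℤ ℂ (PowerSeries.X * PowerSeries.mk w)

/-- The transformed function `x - β_0 - w_0 / f`. -/
def stieltjesTilde (w : ℕ → ℂ) : LaurentSeries ℂ :=
  HahnSeries.single (-1) 1 - HahnSeries.C (recBeta w 0) - HahnSeries.C (w 0) / stieltjes w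

/-- The moments of the transformed function: the coefficients of `1/x^{n+1}` in its expansion. -/
def momentTilde (w : ℕ → ℂ) (n : ℕ) : ℂ :=
  (stieltjesTilde w).coeff ((n : ℤ) + 1)

/-! ### The modified Jacobi weight `x^α (1-x)^β (x-t)^μ` on arcs joining `0`, `1`, `t` -/

/-- Labels of the three singular points `0`, `1`, `t` of the weight. -/
inductive SingPt where
  | zero : SingPt
  | one : SingPt
  | tee : SingPt

/-- The position of a singular point. -/
def SingPt.pos (t : ℂ) : SingPt → ℂ
  | .zero => 0
  | .one => 1
  | .tee => t

/-- The exponent of the weight at a singular point. -/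
def SingPt.expo (α β μ : ℂ) : SingPt → ℂ
  | .zero => α
  | .one => β
  | .tee => μ

/-- One arc of the support of the weight, deforming with `t ∈ U`, together with a branch of the
weight along it. The arc `s ↦ path t s`, `0 ≤ s ≤ 1`, joins two of the points `0`, `1`, `t`, meets
none of them for `0 < s < 1`, has non-zero velocity at both ends, and depends holomorphically
on `t`. -/
structure JacobiArc (α β μ : ℂ) (U : Set ℂ) where
  /-- initial point -/
  src : SingPt
  /-- final point -/
  tgt : SingPt
  /-- the arc at the parameter `t` -/
  path : ℂ → ℝ → ℂ
  contDiffOn_path : ContDiffOn ℝ 2 (fun p : ℂ × ℝ => path p.1 p.2) (U ×ˢ Set.univ)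
  differentiableOn_path : ∀ s ∈ Set.Icc (0 : ℝ) 1, DifferentiableOn ℂ (fun t => path t s) U
  path_zero : ∀ t ∈ U, path t 0 = src.pos t
  path_one : ∀ t ∈ U, path t 1 = tgt.pos t
  path_ne : ∀ t ∈ U, ∀ s ∈ Set.Ioo (0 : ℝ) 1, ∀ e : SingPt, path t s ≠ e.pos t
  deriv_path_zero : ∀ t ∈ U, deriv (path t) 0 ≠ 0
  deriv_path_one : ∀ t ∈ U, deriv (path t) 1 ≠ 0
  /-- a continuous branch of `log x` along the arc -/
  logX : ℂ → ℝ → ℂ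
  /-- a continuous branch of `log (1 - x)` along the arc -/
  logOneSub : ℂ → ℝ → ℂ
  /-- a continuous branch of `log (x - t)` along the arc -/
  logSubT : ℂ → ℝ → ℂ
  continuousOn_logX :
    ContinuousOn (fun p : ℂ × ℝ => logX p.1 p.2) (U ×ˢ Set.Ioo 0 1)
  continuousOn_logOneSub :
    ContinuousOn (fun p : ℂ × ℝ => logOneSub p.1 p.2) (U ×ˢ Set.Ioo 0 1)
  continuousOn_logSubT :
    ContinuousOn (fun p : ℂ × ℝ => logSubT p.1 p.2) (U ×ˢ Set.Ioo 0 1)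
  exp_logX : ∀ t ∈ U, ∀ s ∈ Set.Ioo (0 : ℝ) 1, Complex.exp (logX t s) = path t s
  exp_logOneSub : ∀ t ∈ U, ∀ s ∈ Set.Ioo (0 : ℝ) 1, Complex.exp (logOneSub t s) = 1 - path t s
  exp_logSubT : ∀ t ∈ U, ∀ s ∈ Set.Ioo (0 : ℝ) 1, Complex.exp (logSubT t s) = path t s - t
  /-- a constant multiple of the weight is allowed on each arc -/
  coef : ℂ
  /-- the weight is integrable at the initial point, so that all moments exist -/
  src_expo : -1 < (src.expo α β μ).re
  /-- the weight is integrable at the final point, so that all moments exist -/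
  tgt_expo : -1 < (tgt.expo α β μ).re

/-- The value of the weight `c x^α (1-x)^β (x-t)^μ` at the point `x = path t s` of an arc. -/
def JacobiArc.weight {α β μ : ℂ} {U : Set ℂ} (Γ : JacobiArc α β μ U) (t : ℂ) (s : ℝ) : ℂ :=
  Γ.coef * Complex.exp (α * Γ.logX t s + β * Γ.logOneSub t s + μ * Γ.logSubT t s)

/-- The moments `w_n(t) = ∫ x^n w(x,t) dx` over a finite system of arcs. -/
def jacobiMoment {α β μ : ℂ} {U : Set ℂ} {ι : Type*} [Fintype ι] (Γ : ι → JacobiArc α β μ U)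
    (t : ℂ) (n : ℕ) : ℂ :=
  ∑ i, ∫ s in (0 : ℝ)..1, (Γ i).path t s ^ n * (Γ i).weight t s * deriv ((Γ i).path t) s

/-! ### The deformed Laguerre-Hahn family -/

/-- The coefficient `β_n` in the recurrence of the monic orthogonal polynomials
of the transformed Stieltjes function, as a function of `t`. -/
def betaTilde {α β μ : ℂ} {U : Set ℂ} {ι : Type*} [Fintype ι] (Γ : ι → JacobiArc α β μ U)
    (n : ℕ) (t : ℂ) : ℂ :=
  recBeta (momentTilde (jacobiMoment Γ t)) n

/-- The coefficient `γ_n` in the recurrence of the monic orthogonal polynomials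
of the transformed Stieltjes function, as a function of `t`. -/
def gammaTilde {α β μ : ℂ} {U : Set ℂ} {ι : Type*} [Fintype ι] (Γ : ι → JacobiArc α β μ U)
    (n : ℕ) (t : ℂ) : ℂ :=
  recGamma (momentTilde (jacobiMoment Γ t)) n

/-- `ν_n = 2n + 5 + α + β + μ`. -/
def nu (α β μ : ℂ) (n : ℕ) : ℂ :=
  2 * n + 5 + α + β + μ

end LaguerreHahn

end

noncomputable section
namespace LaguerreHahn

/-! ### The moment functional -/

/-! The map `f ↦ x - β₀ - w₀ / f` strips the first level off the continued fraction of `f`. The new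
recurrence coefficients are therefore the old ones shifted by one, `β̃ₙ = βₙ₊₁` and `γ̃ₙ = γₙ₊₁`
(`recBeta_momentTilde`, `recGamma_momentTilde`). What remains is a pair of Toda-type equations for
the weight itself.

The field `x(x-1)∂ₓ + t(t-1)∂ₜ` is compatible with the motion of the points `0, 1, t` and multiplies
`w` by the polynomial `α(x-1) + βx + μ(x+t-1)`. Adding the divergence `2x-1` and integrating by
parts without boundary terms gives, with `S = α+β+μ`, `κ = μ(t-1)-1-α` and `T = t(t-1)`, the
relation `T wₙ' = (n+2+S) wₙ₊₁ + (κ-n) wₙ` (`exists_hasDerivAt_jacobiMoment`). For the moment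
functional `L` this reads `T L'(p) = L(x(x-1)p') + (2+S) L(xp) + κ L(p)` (`MomentFlow.functional`).

Since `∂ₜPₙ` has degree below `n`, applying this to `Pₙ²` gives the derivative of `hₙ`
(`recH_flow`), and applying it to `Pₙ₊₁Pₙ` gives that of the subleading coefficient (`recSub_flow`).
As `βₙ` is a difference of subleading coefficients and `γₙ` a quotient of norms, both equations
follow, and `κ` drops out. -/

/-- The moment functional as a linear map. -/
def momentLin (w : ℕ → ℂ) : ℂ[X] →ₗ[ℂ] ℂ :=
  Polynomial.lsum fun i => LinearMap.mulRight ℂ (w i)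

theorem momentFunctional_eq (w : ℕ → ℂ) (p : ℂ[X]) : momentFunctional w p = momentLin w p := rfl

theorem momentLin_C_mul (w : ℕ → ℂ) (a : ℂ) (p : ℂ[X]) :
    momentLin w (C a * p) = a * momentLin w p := by
  rw [← smul_eq_C_mul, map_smul, smul_eq_mul]

theorem momentLin_monomial (w : ℕ → ℂ) (i : ℕ) (a : ℂ) :
    momentLin w (monomial i a) = a * w i := by
  simp [momentLin, sum_monomial_index]

theorem momentLin_X_pow (w : ℕ → ℂ) (i : ℕ) : momentLin w (X ^ i) = w i := by
  simpa [monomial_one_right_eq_X_pow] using momentLin_monomial w i 1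

theorem momentLin_eq_sum_range (w : ℕ → ℂ) {p : ℂ[X]} {N : ℕ} (hp : p.natDegree < N) :
    momentLin w p = ∑ i ∈ Finset.range N, p.coeff i * w i :=
  sum_over_range' p (fun i => zero_mul (w i)) N hp

theorem momentLin_mul_eq_zero {w : ℕ → ℂ} {n : ℕ} {P q : ℂ[X]}
    (hP : ∀ m < n, momentLin w (X ^ m * P) = 0) (hq : q.degree < n) :
    momentLin w (q * P) = 0 := by
  rcases eq_or_ne q 0 with rfl | h0
  · simp
  rw [q.as_sum_range' n ((natDegree_lt_iff_degree_lt h0).2 hq), Finset.sum_mul, map_sum]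
  refine Finset.sum_eq_zero fun i hi => ?_
  rw [← C_mul_X_pow_eq_monomial, mul_assoc, momentLin_C_mul, hP i (Finset.mem_range.1 hi), mul_zero]

theorem degree_sub_C_mul_X_pow_lt {q : ℂ[X]} {n : ℕ} (hq : q.degree < (n + 1 : ℕ)) :
    (q - C (q.coeff n) * X ^ n).degree < (n : WithBot ℕ) := by
  rw [degree_lt_iff_coeff_zero]
  intro m hm
  rcases hm.eq_or_lt with rfl | h
  · simp
  · rw [coeff_sub, coeff_C_mul_X_pow, if_neg h.ne', sub_zero]
    exact (degree_lt_iff_coeff_zero _ _).1 hq m h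

/-- A polynomial of degree at most `n` is paired with `P_n` through its top coefficient only. -/
theorem momentLin_mul_eq_coeff_mul {w : ℕ → ℂ} {n : ℕ} {P q : ℂ[X]}
    (hP : ∀ m < n, momentLin w (X ^ m * P) = 0) (hq : q.degree < (n + 1 : ℕ)) :
    momentLin w (q * P) = q.coeff n * momentLin w (X ^ n * P) := by
  have h := momentLin_mul_eq_zero hP (degree_sub_C_mul_X_pow_lt hq)
  rw [sub_mul, map_sub, mul_assoc, momentLin_C_mul, sub_eq_zero] at h
  exact h

theorem IsMonicOP.orth {w : ℕ → ℂ} {n : ℕ} {P : ℂ[X]} (h : IsMonicOP w n P) :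
    ∀ m < n, momentLin w (X ^ m * P) = 0 := h.2.2

theorem IsMonicOP.degree_lt {w : ℕ → ℂ} {n N : ℕ} {P : ℂ[X]} (h : IsMonicOP w n P) (hN : n < N) :
    P.degree < N := by
  have := h.2.1
  exact (degree_le_natDegree).trans_lt (by rw [this]; exact_mod_cast hN)

theorem IsMonicOP.coeff_self {w : ℕ → ℂ} {n : ℕ} {P : ℂ[X]} (h : IsMonicOP w n P) :
    P.coeff n = 1 := by
  have := h.1.coeff_natDegree
  rwa [h.2.1] at this

theorem IsMonicOP.sq_eq {w : ℕ → ℂ} {n : ℕ} {P : ℂ[X]} (h : IsMonicOP w n P) :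
    momentLin w (P ^ 2) = momentLin w (X ^ n * P) := by
  rw [pow_two, momentLin_mul_eq_coeff_mul h.orth (h.degree_lt n.lt_succ_self), h.coeff_self, one_mul]

theorem IsMonicOP.mul_eq {w : ℕ → ℂ} {n : ℕ} {P q : ℂ[X]} (h : IsMonicOP w n P)
    (hq : q.degree < (n + 1 : ℕ)) :
    momentLin w (q * P) = q.coeff n * momentLin w (P ^ 2) := by
  rw [momentLin_mul_eq_coeff_mul h.orth hq, h.sq_eq]

/-- A nonzero difference of degree `k < n` is orthogonal to `R k`, which forces its leading
coefficient times the norm of `R k` to vanish. Any orthogonal family with nonzero norms may serve as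
`R`, so the same argument identifies `monicOP` with `recOP` and, for the transformed moments, with
`tildeOP`. -/
theorem IsMonicOP.unique {w : ℕ → ℂ} {n : ℕ} {R : ℕ → ℂ[X]}
    (hR : ∀ k < n, IsMonicOP w k (R k)) (hR0 : ∀ k < n, momentLin w (R k ^ 2) ≠ 0)
    {P Q : ℂ[X]} (hP : IsMonicOP w n P) (hQ : IsMonicOP w n Q) : P = Q := by
  by_contra hne
  have hD : P - Q ≠ 0 := sub_ne_zero.2 hne
  have hlt : (P - Q).natDegree < n := by
    have h1 : (P - Q).degree < P.degree := by
      refine degree_sub_lt_left ?_ hP.1.ne_zero (by rw [hP.1.leadingCoeff, hQ.1.leadingCoeff])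
      rw [degree_eq_natDegree hP.1.ne_zero, degree_eq_natDegree hQ.1.ne_zero, hP.2.1, hQ.2.1]
    rw [natDegree_lt_iff_degree_lt hD]
    rwa [degree_eq_natDegree hP.1.ne_zero, hP.2.1] at h1
  set k := (P - Q).natDegree with hk
  have h0 : momentLin w ((P - Q) * R k) = 0 := by
    rw [mul_comm]
    refine momentLin_mul_eq_zero (n := n) (fun m hm => ?_) ((hR k hlt).degree_lt hlt)
    rw [mul_sub, map_sub, hP.orth m hm, hQ.orth m hm, sub_zero]
  rw [(hR k hlt).mul_eq (degree_le_natDegree.trans_lt (by exact_mod_cast k.lt_succ_self))] at h0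
  rcases mul_eq_zero.1 h0 with h | h
  · exact hD (leadingCoeff_eq_zero.1 h)
  · exact hR0 k hlt h

theorem monicOP_eq {w : ℕ → ℂ} {n : ℕ} {R : ℕ → ℂ[X]}
    (hR : ∀ k ≤ n, IsMonicOP w k (R k)) (hR0 : ∀ k < n, momentLin w (R k ^ 2) ≠ 0) :
    monicOP w n = R n :=
  IsMonicOP.unique (fun k hk => hR k hk.le) hR0
    (Classical.epsilon_spec (p := IsMonicOP w n) ⟨R n, hR n le_rfl⟩) (hR n le_rfl)

/-! ### The polynomials generated by the three-term recurrence -/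

/-- The polynomials generated by the three-term recurrence, with the coefficients that make
them orthogonal whenever the squared norms do not vanish. -/
def recOP (w : ℕ → ℂ) : ℕ → ℂ[X]
  | 0 => 1
  | 1 => X - C (momentLin w (X * 1 ^ 2) / momentLin w (1 ^ 2))
  | n + 2 => (X - C (momentLin w (X * recOP w (n + 1) ^ 2) / momentLin w (recOP w (n + 1) ^ 2))) *
      recOP w (n + 1) - C (momentLin w (recOP w (n + 1) ^ 2) / momentLin w (recOP w n ^ 2)) * recOP w n

/-- The squared norm of `recOP w n`. -/
def recH (w : ℕ → ℂ) (n : ℕ) : ℂ := momentLin w (recOP w n ^ 2)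

/-- The diagonal recurrence coefficient. -/
def recB (w : ℕ → ℂ) (n : ℕ) : ℂ := momentLin w (X * recOP w n ^ 2) / recH w n

theorem recOP_zero (w : ℕ → ℂ) : recOP w 0 = 1 := by rw [recOP]

theorem recOP_one (w : ℕ → ℂ) : recOP w 1 = (X - C (recB w 0)) * recOP w 0 := by
  rw [recB, recH, recOP_zero, mul_one, recOP]

theorem recOP_add_two (w : ℕ → ℂ) (n : ℕ) :
    recOP w (n + 2) = (X - C (recB w (n + 1))) * recOP w (n + 1)
      - C (recH w (n + 1) / recH w n) * recOP w n := by
  rw [recOP, recB, recH, recH]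

/-- No norm needs to be nonzero: a division by zero only spoils coefficients below the top one. This
gives the degree bounds for all parameter values that differentiation in `t` uses. -/
theorem recOP_monic_natDegree (w : ℕ → ℂ) (n : ℕ) :
    (recOP w n).Monic ∧ (recOP w n).natDegree = n := by
  induction n using Nat.twoStepInduction with
  | zero => simp [recOP_zero]
  | one => rw [recOP_one, recOP_zero, mul_one]; exact ⟨monic_X_sub_C _, natDegree_X_sub_C _⟩
  | more n h0 h1 =>
    rw [recOP_add_two]
    have hm : ((X - C (recB w (n + 1))) * recOP w (n + 1)).Monic := (monic_X_sub_C _).mul h1.1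
    have hd : ((X - C (recB w (n + 1))) * recOP w (n + 1)).natDegree = n + 2 := by
      rw [(monic_X_sub_C _).natDegree_mul h1.1, natDegree_X_sub_C, h1.2]; ring
    have hlt : (C (recH w (n + 1) / recH w n) * recOP w n).degree
        < ((X - C (recB w (n + 1))) * recOP w (n + 1)).degree := by
      rw [degree_eq_natDegree hm.ne_zero, hd]
      refine degree_le_natDegree.trans_lt ?_
      have := natDegree_C_mul_le (recH w (n + 1) / recH w n) (recOP w n)
      rw [h0.2] at this
      exact_mod_cast (by omega : (C (recH w (n + 1) / recH w n) * recOP w n).natDegree < n + 2)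
    exact ⟨hm.sub_of_left hlt, by rw [natDegree_sub_eq_left_of_natDegree_lt, hd]
                                  rw [hd]; exact (natDegree_C_mul_le _ _).trans_lt (by omega)⟩

theorem recOP_coeff_self (w : ℕ → ℂ) (n : ℕ) : (recOP w n).coeff n = 1 := by
  have h := (recOP_monic_natDegree w n).1.coeff_natDegree
  rwa [(recOP_monic_natDegree w n).2] at h

theorem recOP_coeff_of_lt (w : ℕ → ℂ) {n m : ℕ} (h : n < m) : (recOP w n).coeff m = 0 :=
  coeff_eq_zero_of_natDegree_lt (by rwa [(recOP_monic_natDegree w n).2])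

/-- The coefficient of `X ^ (n - 1)` in `recOP w n`. -/
def recSub (w : ℕ → ℂ) (n : ℕ) : ℂ := (X * recOP w n).coeff n

/-- The factor `X` in `recSub` replaces the index `n - 1` by `n`, so that `n = 0` gives `0` and
`recB_eq` has no exceptional case. -/
theorem recSub_zero (w : ℕ → ℂ) : recSub w 0 = 0 := by simp [recSub]

theorem recSub_succ (w : ℕ → ℂ) (n : ℕ) : recSub w (n + 1) = (recOP w (n + 1)).coeff n := by
  rw [recSub, coeff_X_mul]

theorem recB_eq (w : ℕ → ℂ) (n : ℕ) : recB w n = recSub w n - recSub w (n + 1) := by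
  rcases n with _ | n
  · rw [recSub_zero, recSub_succ, recOP_one, recOP_zero]
    simp
  · rw [recSub_succ, recSub_succ, recOP_add_two]
    simp [sub_mul, coeff_X_mul, recOP_coeff_self, recOP_coeff_of_lt]

/-- The second subleading coefficients enter `recSub_flow`; this relation eliminates them once
consecutive equations are subtracted. -/
theorem recOP_coeff_sub_two (w : ℕ → ℂ) (n : ℕ) :
    (recOP w (n + 3)).coeff (n + 1) = (recOP w (n + 2)).coeff n
      - recB w (n + 2) * recSub w (n + 2) - recH w (n + 2) / recH w (n + 1) := by
  rw [recOP_add_two, recSub_succ]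
  simp [sub_mul, coeff_X_mul, recOP_coeff_self]

/-- Orthogonality to low powers is inherited through the recurrence; the two remaining powers are
settled by the choice of `γ` and of `β`. The norm of index `N` itself may vanish, which the Hankel
determinant argument needs. -/
theorem isMonicOP_recOP {w : ℕ → ℂ} {N : ℕ} (hN : ∀ k < N, recH w k ≠ 0) :
    ∀ k ≤ N, IsMonicOP w k (recOP w k) := by
  have key : ∀ k ≤ N, ∀ m < k, momentLin w (X ^ m * recOP w k) = 0 := by
    intro k
    induction k using Nat.twoStepInduction with
    | zero => intro _ m hm; omega
    | one =>
      intro h1 m hm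
      obtain rfl : m = 0 := by omega
      have h0 := hN 0 (by omega)
      rw [recOP_one, pow_zero, one_mul, sub_mul, map_sub, momentLin_C_mul, recB]
      rw [recH, recOP_zero, one_pow] at *
      field_simp
      simp
    | more n h0 h1 =>
      intro hn
      have e0 : IsMonicOP w n (recOP w n) :=
        ⟨(recOP_monic_natDegree w n).1, (recOP_monic_natDegree w n).2, h0 (by omega)⟩
      have e1 : IsMonicOP w (n + 1) (recOP w (n + 1)) :=
        ⟨(recOP_monic_natDegree w _).1, (recOP_monic_natDegree w _).2, h1 (by omega)⟩
      have n0 := hN n (by omega)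
      have n1 := hN (n + 1) (by omega)
      have hlow : ∀ m < n, momentLin w (X ^ m * recOP w (n + 2)) = 0 := by
        intro m hm
        have : X ^ m * recOP w (n + 2) = X ^ (m + 1) * recOP w (n + 1)
            - C (recB w (n + 1)) * (X ^ m * recOP w (n + 1))
            - C (recH w (n + 1) / recH w n) * (X ^ m * recOP w n) := by
          rw [recOP_add_two]; ring
        rw [this, map_sub, map_sub, momentLin_C_mul, momentLin_C_mul, e1.orth _ (by omega),
          e1.orth _ (by omega), e0.orth _ hm]
        simp
      have hmid : momentLin w (X ^ n * recOP w (n + 2)) = 0 := by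
        have : X ^ n * recOP w (n + 2) = X ^ (n + 1) * recOP w (n + 1)
            - C (recB w (n + 1)) * (X ^ n * recOP w (n + 1))
            - C (recH w (n + 1) / recH w n) * (X ^ n * recOP w n) := by
          rw [recOP_add_two]; ring
        rw [this, map_sub, map_sub, momentLin_C_mul, momentLin_C_mul, e1.orth n (by omega),
          ← e1.sq_eq, ← e0.sq_eq, ← recH, ← recH]
        field_simp
        simp
      have hlow' : ∀ m < n + 1, momentLin w (X ^ m * recOP w (n + 2)) = 0 := by
        intro m hm
        rcases (Nat.lt_succ_iff_lt_or_eq.1 hm) with h | rfl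
        exacts [hlow m h, hmid]
      have htop : momentLin w (recOP w (n + 1) * recOP w (n + 2)) = 0 := by
        have : recOP w (n + 1) * recOP w (n + 2) = X * recOP w (n + 1) ^ 2
            - C (recB w (n + 1)) * recOP w (n + 1) ^ 2
            - C (recH w (n + 1) / recH w n) * (recOP w n * recOP w (n + 1)) := by
          rw [recOP_add_two]; ring
        rw [this, map_sub, map_sub, momentLin_C_mul, momentLin_C_mul,
          momentLin_mul_eq_zero e1.orth (e0.degree_lt (by omega)), ← recH, recB]
        field_simp
        simp
      -- All lower powers being annihilated already, pairing with the monic polynomial of degree `n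
      -- + 1` is pairing with `X ^ (n + 1)`.
      rw [momentLin_mul_eq_coeff_mul hlow' (e1.degree_lt (by omega)), e1.coeff_self, one_mul] at htop
      intro m hm
      rcases (Nat.lt_succ_iff_lt_or_eq.1 hm) with h | rfl
      exacts [hlow' m h, htop]
  exact fun k hk => ⟨(recOP_monic_natDegree w k).1, (recOP_monic_natDegree w k).2, key k hk⟩

theorem monicOP_eq_recOP {w : ℕ → ℂ} {n : ℕ} (hN : ∀ k < n, recH w k ≠ 0) :
    monicOP w n = recOP w n :=
  monicOP_eq (isMonicOP_recOP hN) hN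

/-- If `hₙ = 0`, then `Pₙ` is orthogonal to `X ^ n` as well, and its coefficient vector is a nonzero
kernel vector of the Hankel matrix of size `n + 1`. -/
theorem recH_ne_zero_of_hankelDet_ne_zero {w : ℕ → ℂ} (hw : ∀ k, hankelDet w k ≠ 0) (n : ℕ) :
    recH w n ≠ 0 := by
  induction n using Nat.strong_induction_on with
  | _ n ih =>
    intro h0
    have hP := isMonicOP_recOP ih n le_rfl
    refine hw (n + 1) (Matrix.exists_mulVec_eq_zero_iff.1
      ⟨fun j : Fin (n + 1) => (recOP w n).coeff j, fun h => ?_, ?_⟩)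
    · have := congrFun h (Fin.last n)
      simp [recOP_coeff_self] at this
    · ext i
      have hi : momentLin w (X ^ (i : ℕ) * recOP w n) = 0 := by
        rcases Nat.lt_succ_iff_lt_or_eq.1 i.2 with h | h
        · exact hP.orth _ h
        · rw [h, ← hP.sq_eq]; exact h0
      rw [(recOP w n).as_sum_range' (n + 1) (by rw [hP.2.1]; omega), Finset.mul_sum, map_sum,
        Finset.sum_range] at hi
      simp only [Matrix.mulVec, dotProduct, Matrix.of_apply, Pi.zero_apply]
      rw [← hi]
      refine Finset.sum_congr rfl fun j _ => ?_
      rw [X_pow_mul_monomial, momentLin_monomial, mul_comm, Nat.add_comm (i : ℕ)]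

/-- Replacing `X ^ (n + 1)` by `X * Pₙ` costs the subleading coefficient of `Pₙ`, and `βₙ - recSub n
= -recSub (n + 1)`. -/
theorem momentLin_X_pow_succ_mul_recOP {w : ℕ → ℂ} {n : ℕ} (hN : ∀ k ≤ n, recH w k ≠ 0) :
    momentLin w (X ^ (n + 1) * recOP w n) = -recSub w (n + 1) * recH w n := by
  have hP := isMonicOP_recOP (fun k hk => hN k (Nat.le_of_lt hk)) n le_rfl
  have hd : (X * recOP w n - X ^ (n + 1)).degree < ((n + 1 : ℕ) : WithBot ℕ) := by
    have := degree_sub_C_mul_X_pow_lt (q := X * recOP w n) (n := n + 1) (by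
      have h2 : (X * recOP w n).natDegree = n + 1 := by
        rw [natDegree_X_mul hP.1.ne_zero, hP.2.1]
      refine degree_le_natDegree.trans_lt ?_
      rw [h2]; exact_mod_cast (n + 1).lt_succ_self)
    rwa [coeff_X_mul, recOP_coeff_self, C_1, one_mul] at this
  have h1 := hP.mul_eq hd
  have h2 : recB w n * recH w n = momentLin w (X * recOP w n ^ 2) :=
    div_mul_cancel₀ _ (hN n le_rfl)
  rw [sub_mul, map_sub, mul_assoc, ← pow_two, ← h2, coeff_sub, coeff_X_pow, if_neg (by omega),
    sub_zero, ← recSub, ← recH, recB_eq] at h1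
  linear_combination -h1

/-! ### The transformed Stieltjes function shifts the recurrence coefficients -/

/-- Polynomials in `x` as Laurent series in `1 / x`. -/
def polyLaurent : ℂ[X] →+* LaurentSeries ℂ :=
  eval₂RingHom HahnSeries.C (HahnSeries.single (-1) 1)

theorem polyLaurent_monomial (i : ℕ) (a : ℂ) :
    polyLaurent (monomial i a) = HahnSeries.single (-(i : ℤ)) a := by
  rw [polyLaurent, coe_eval₂RingHom, eval₂_monomial, HahnSeries.single_pow, one_pow,
    HahnSeries.C_apply, HahnSeries.single_mul_single]
  simp

theorem polyLaurent_X : polyLaurent X = HahnSeries.single (-1) 1 := eval₂_X _ _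

theorem polyLaurent_C (a : ℂ) : polyLaurent (C a) = HahnSeries.C a := eval₂_C _ _

theorem coeff_mul_polyLaurent (g : LaurentSeries ℂ) (p : ℂ[X]) (k : ℤ) :
    (g * polyLaurent p).coeff k = p.sum fun i a => a * g.coeff (k + i) := by
  induction p using Polynomial.induction_on' with
  | add p q hp hq =>
    rw [map_add, mul_add, HahnSeries.coeff_add, hp, hq,
      sum_add_index _ _ _ (fun i => zero_mul _) (fun i a b => add_mul _ _ _)]
  | monomial i a =>
    rw [polyLaurent_monomial, HahnSeries.coeff_mul_single, sum_monomial_index a _ (zero_mul _),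
      sub_neg_eq_add, mul_comm]

theorem coeff_polyLaurent_of_pos (p : ℂ[X]) {k : ℤ} (hk : 0 < k) :
    (polyLaurent p).coeff k = 0 := by
  rw [← one_mul (polyLaurent p), coeff_mul_polyLaurent]
  refine Finset.sum_eq_zero fun i _ => ?_
  beta_reduce
  rw [HahnSeries.coeff_one, if_neg (by omega), mul_zero]

theorem coeff_polyLaurent_neg (p : ℂ[X]) (j : ℕ) :
    (polyLaurent p).coeff (-(j : ℤ)) = p.coeff j := by
  rw [← one_mul (polyLaurent p), coeff_mul_polyLaurent, sum_def, Finset.sum_eq_single j]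
  · simp
  · intro i _ hi
    rw [HahnSeries.coeff_one, if_neg (by omega), mul_zero]
  · intro h
    simp [notMem_support_iff.1 h]

/-- This is the dictionary between series and functionals: orthogonality to low degrees means that
the coefficients of `1/x, 1/x², …` in `g * p` vanish. A polynomial part of `g` does not matter. -/
theorem coeff_succ_mul_polyLaurent {g : LaurentSeries ℂ} {m : ℕ → ℂ}
    (hg : ∀ j : ℕ, g.coeff ((j : ℤ) + 1) = m j) (p : ℂ[X]) (k : ℕ) :
    (g * polyLaurent p).coeff ((k : ℤ) + 1) = momentLin m (X ^ k * p) := by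
  rw [coeff_mul_polyLaurent]
  conv_rhs => rw [p.as_sum_support, Finset.mul_sum, map_sum]
  refine Finset.sum_congr rfl fun i _ => ?_
  rw [X_pow_mul_monomial, momentLin_monomial, ← hg]
  push_cast
  ring_nf

theorem stieltjes_eq (w : ℕ → ℂ) : stieltjes w =
    HahnSeries.single 1 1 * HahnSeries.ofPowerSeries ℤ ℂ (PowerSeries.mk w) := by
  rw [stieltjes, map_mul, HahnSeries.ofPowerSeries_X]

theorem coeff_stieltjes_succ (w : ℕ → ℂ) (j : ℕ) : (stieltjes w).coeff ((j : ℤ) + 1) = w j := by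
  rw [stieltjes_eq, HahnSeries.coeff_single_mul, one_mul, add_sub_cancel_right,
    HahnSeries.ofPowerSeries_apply_coeff, PowerSeries.coeff_mk]

theorem coeff_stieltjes_nonpos (w : ℕ → ℂ) {k : ℤ} (hk : k ≤ 0) : (stieltjes w).coeff k = 0 := by
  rw [stieltjes_eq, HahnSeries.coeff_single_mul, one_mul, PowerSeries.coeff_coe, if_pos (by omega)]

/-- The monic orthogonal polynomials of the transformed Stieltjes function: the polynomial part of
`f P_{n+1} / w_0`. -/
def tildeOP (w : ℕ → ℂ) (n : ℕ) : ℂ[X] :=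
  ∑ j ∈ Finset.range (n + 1), monomial j
    ((w 0)⁻¹ * (stieltjes w * polyLaurent (recOP w (n + 1))).coeff (-(j : ℤ)))

theorem coeff_stieltjes_mul_recOP (w : ℕ → ℂ) (n j : ℕ) :
    (stieltjes w * polyLaurent (recOP w n)).coeff (-(j : ℤ)) =
      ∑ i ∈ Finset.range (n + 1), (recOP w n).coeff i * (stieltjes w).coeff (-(j : ℤ) + i) := by
  rw [coeff_mul_polyLaurent]
  exact sum_over_range' _ (fun i => zero_mul _) _ (by rw [(recOP_monic_natDegree w n).2]; omega)

theorem coeff_stieltjes_mul_recOP_of_le (w : ℕ → ℂ) {n j : ℕ} (h : n ≤ j) :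
    (stieltjes w * polyLaurent (recOP w n)).coeff (-(j : ℤ)) = 0 := by
  rw [coeff_stieltjes_mul_recOP]
  refine Finset.sum_eq_zero fun i hi => ?_
  rw [coeff_stieltjes_nonpos w (by have := Finset.mem_range.1 hi; omega), mul_zero]

theorem coeff_tildeOP {w : ℕ → ℂ} (hw : w 0 ≠ 0) (n j : ℕ) :
    w 0 * (tildeOP w n).coeff j =
      (stieltjes w * polyLaurent (recOP w (n + 1))).coeff (-(j : ℤ)) := by
  rw [tildeOP, finsetSum_coeff]
  simp only [coeff_monomial]
  rw [Finset.sum_ite_eq' (Finset.range (n + 1)) j]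
  split_ifs with h
  · rw [mul_inv_cancel_left₀ hw]
  · rw [coeff_stieltjes_mul_recOP_of_le w (by simpa using h), mul_zero]

theorem coeff_tildeOP_of_lt {w : ℕ → ℂ} (hw : w 0 ≠ 0) {n j : ℕ} (h : n < j) :
    (tildeOP w n).coeff j = 0 := by
  have := coeff_tildeOP hw n j
  rw [coeff_stieltjes_mul_recOP_of_le w h] at this
  exact (mul_eq_zero.1 this).resolve_left hw

theorem coeff_tildeOP_self {w : ℕ → ℂ} (hw : w 0 ≠ 0) (n : ℕ) : (tildeOP w n).coeff n = 1 := by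
  have := coeff_tildeOP hw n n
  rw [coeff_stieltjes_mul_recOP, Finset.sum_range_succ, recOP_coeff_self, Finset.sum_eq_zero,
    show (-(n : ℤ) + ((n + 1 : ℕ) : ℤ)) = ((0 : ℕ) : ℤ) + 1 by push_cast; ring,
    coeff_stieltjes_succ, zero_add, one_mul] at this
  · exact mul_left_cancel₀ hw (by rw [this, mul_one])
  · intro i hi
    rw [coeff_stieltjes_nonpos w (by have := Finset.mem_range.1 hi; omega), mul_zero]

theorem recSub_one {w : ℕ → ℂ} : recSub w 1 = -(w 1 / w 0) := by
  have h := recB_eq w 0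
  rw [recSub_zero, recB, recH, recOP_zero, one_pow, mul_one] at h
  have h1 := momentLin_X_pow w 1
  have h0 := momentLin_X_pow w 0
  rw [pow_one] at h1
  rw [pow_zero] at h0
  rw [h1, h0] at h
  linear_combination h

theorem coeff_X_mul_tildeOP {w : ℕ → ℂ} (hw : w 0 ≠ 0) (n : ℕ) :
    (X * tildeOP w n).coeff n = recSub w (n + 1) - recSub w 1 := by
  rcases n with _ | n
  · simp
  · rw [coeff_X_mul]
    have := coeff_tildeOP hw (n + 1) n
    rw [coeff_stieltjes_mul_recOP, Finset.sum_range_succ, Finset.sum_range_succ, recOP_coeff_self,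
      Finset.sum_eq_zero,
      show (-(n : ℤ) + ((n + 1 + 1 : ℕ) : ℤ)) = ((1 : ℕ) : ℤ) + 1 by push_cast; ring,
      show (-(n : ℤ) + ((n + 1 : ℕ) : ℤ)) = ((0 : ℕ) : ℤ) + 1 by push_cast; ring,
      coeff_stieltjes_succ, coeff_stieltjes_succ, zero_add, one_mul, ← recSub_succ] at this
    · rw [recSub_one]
      field_simp
      linear_combination this
    · intro i hi
      rw [coeff_stieltjes_nonpos w (by have := Finset.mem_range.1 hi; omega), mul_zero]

/-- The leading coefficients of the quotient by `f` of a series of order `n + 2`. -/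
theorem coeff_tilde_remainder {w : ℕ → ℂ} (hw : w 0 ≠ 0) {n : ℕ} {E : LaurentSeries ℂ} {e : ℕ → ℂ}
    (hE0 : ∀ k : ℤ, k < n + 2 → E.coeff k = 0) (hE : ∀ j : ℕ, E.coeff ((n : ℤ) + 2 + j) = e j) :
    (∀ k : ℤ, k < n + 1 → (E / stieltjes w).coeff k = 0) ∧
      (E / stieltjes w).coeff ((n : ℤ) + 1) = e 0 / w 0 ∧
      (E / stieltjes w).coeff ((n : ℤ) + 2) = (e 1 + e 0 * recSub w 1) / w 0 := by
  set W := PowerSeries.mk w with hW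
  have hW0 : PowerSeries.constantCoeff W ≠ 0 := by
    rw [← PowerSeries.coeff_zero_eq_constantCoeff_apply, hW, PowerSeries.coeff_mk]; exact hw
  have hWi : W * W⁻¹ = 1 := PowerSeries.mul_inv_cancel _ hW0
  have hf0 : stieltjes w ≠ 0 := fun h => hw (by
    have := coeff_stieltjes_succ w 0
    rw [h] at this; simpa using this.symm)
  have hEe : E = HahnSeries.single ((n : ℤ) + 2) 1
      * HahnSeries.ofPowerSeries ℤ ℂ (PowerSeries.mk e) := by
    ext k
    rw [HahnSeries.coeff_single_mul, one_mul, PowerSeries.coeff_coe]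
    split_ifs with h
    · exact hE0 k (by omega)
    · rw [PowerSeries.coeff_mk, ← hE]
      congr 1
      omega
  have hq : E / stieltjes w = HahnSeries.single ((n : ℤ) + 1) 1
      * HahnSeries.ofPowerSeries ℤ ℂ (PowerSeries.mk e * W⁻¹) := by
    rw [div_eq_iff hf0, stieltjes_eq, hEe, mul_mul_mul_comm, HahnSeries.single_mul_single, one_mul,
      ← map_mul, mul_assoc, mul_comm W⁻¹, hWi, mul_one]
    congr 2
  have hv0 : PowerSeries.coeff 0 W⁻¹ = (w 0)⁻¹ := by
    have := congrArg (PowerSeries.coeff 0) hWi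
    rw [PowerSeries.coeff_mul] at this
    simp [hW, -PowerSeries.coeff_zero_eq_constantCoeff] at this
    exact eq_inv_of_mul_eq_one_right this
  have hv1 : w 0 * PowerSeries.coeff 1 W⁻¹ + w 1 * (w 0)⁻¹ = 0 := by
    have := congrArg (PowerSeries.coeff 1) hWi
    rw [PowerSeries.coeff_mul, Finset.Nat.sum_antidiagonal_eq_sum_range_succ
      (fun i j => PowerSeries.coeff i W * PowerSeries.coeff j W⁻¹), Finset.sum_range_succ,
      Finset.sum_range_one, Nat.sub_self, hv0, PowerSeries.coeff_one] at this
    simpa [hW, -PowerSeries.coeff_zero_eq_constantCoeff] using this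
  refine ⟨fun k hk => ?_, ?_, ?_⟩
  · rw [hq, HahnSeries.coeff_single_mul, one_mul, PowerSeries.coeff_coe, if_pos (by omega)]
  · rw [hq, HahnSeries.coeff_single_mul, one_mul, sub_self]
    rw [← Nat.cast_zero, HahnSeries.ofPowerSeries_apply_coeff, PowerSeries.coeff_mul]
    simp [hv0, -PowerSeries.coeff_zero_eq_constantCoeff, div_eq_mul_inv]
  · rw [hq, HahnSeries.coeff_single_mul, one_mul,
      show (n : ℤ) + 2 - (n + 1) = ((1 : ℕ) : ℤ) by push_cast; ring,
      HahnSeries.ofPowerSeries_apply_coeff, PowerSeries.coeff_mul,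
      Finset.Nat.sum_antidiagonal_eq_sum_range_succ
        (fun i j => PowerSeries.coeff i (PowerSeries.mk e) * PowerSeries.coeff j W⁻¹),
      Finset.sum_range_succ, Finset.sum_range_one, Nat.sub_self, hv0, PowerSeries.coeff_mk,
      PowerSeries.coeff_mk, recSub_one]
    have : PowerSeries.coeff 1 W⁻¹ = - w 1 / w 0 / w 0 := by
      field_simp
      field_simp at hv1
      linear_combination hv1
    rw [Nat.sub_zero, this]
    field_simp
    ring

/-- Modulo polynomials, `f̃ T` equals `(f P - w₀ T) / f`. With `P = Pₙ₊₁` and `w₀ T` the polynomial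
part of `f P`, all moments of `f̃` against `T` are read off from this quotient. -/
theorem stieltjesTilde_mul_polyLaurent {w : ℕ → ℂ} (hw : w 0 ≠ 0) (P T : ℂ[X]) :
    stieltjesTilde w * polyLaurent T = polyLaurent ((X - C (recBeta w 0)) * T - P)
      + (stieltjes w * polyLaurent P - polyLaurent (C (w 0) * T)) / stieltjes w := by
  have hf0 : stieltjes w ≠ 0 := fun h => hw (by
    have := coeff_stieltjes_succ w 0
    rw [h] at this; simpa using this.symm)
  rw [stieltjesTilde, map_sub, map_mul, map_sub, map_mul, polyLaurent_X, polyLaurent_C,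
    polyLaurent_C]
  field_simp
  ring

theorem coeff_momentTilde (w : ℕ → ℂ) (j : ℕ) :
    (stieltjesTilde w).coeff ((j : ℤ) + 1) = momentTilde w j := rfl

/-- By orthogonality of `Pₙ₊₁`, the remainder `E = f Pₙ₊₁ - w₀ T` starts at `x^(-n-2)` with
coefficient `hₙ₊₁`. Division by `f = w₀/x + …` moves this to `x^(-n-1)`, which is the orthogonality
of `T` and its norm; the next coefficient is what `β̃ₙ` requires. -/
theorem momentLin_momentTilde {w : ℕ → ℂ} {n : ℕ} (hN : ∀ k ≤ n + 1, recH w k ≠ 0) :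
    (∀ k < n, momentLin (momentTilde w) (X ^ k * tildeOP w n) = 0) ∧
      momentLin (momentTilde w) (X ^ n * tildeOP w n) = recH w (n + 1) / w 0 ∧
      momentLin (momentTilde w) (X ^ (n + 1) * tildeOP w n) =
        (recSub w 1 - recSub w (n + 2)) * (recH w (n + 1) / w 0) := by
  have hw : w 0 ≠ 0 := by
    have := hN 0 (Nat.zero_le _)
    rwa [recH, recOP_zero, one_pow, ← pow_zero X, momentLin_X_pow] at this
  have hP := isMonicOP_recOP (fun k hk => hN k (Nat.le_of_lt hk)) (n + 1) le_rfl
  set E := stieltjes w * polyLaurent (recOP w (n + 1)) - polyLaurent (C (w 0) * tildeOP w n) with hE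
  have hEpos : ∀ k : ℕ, E.coeff ((k : ℤ) + 1) = momentLin w (X ^ k * recOP w (n + 1)) := by
    intro k
    rw [hE, HahnSeries.coeff_sub, coeff_succ_mul_polyLaurent (coeff_stieltjes_succ w),
      coeff_polyLaurent_of_pos _ (by omega), sub_zero]
  have hE0 : ∀ k : ℤ, k < n + 2 → E.coeff k = 0 := by
    intro k hk
    rcases le_or_gt k 0 with h | h
    · obtain ⟨j, rfl⟩ : ∃ j : ℕ, k = -(j : ℤ) := ⟨k.natAbs, by omega⟩
      rw [hE, HahnSeries.coeff_sub, coeff_polyLaurent_neg, coeff_C_mul, coeff_tildeOP hw, sub_self]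
    · obtain ⟨j, rfl⟩ : ∃ j : ℕ, k = (j : ℤ) + 1 := ⟨(k - 1).natAbs, by omega⟩
      rw [hEpos, hP.orth _ (by omega)]
  obtain ⟨h1, h2, h3⟩ := coeff_tilde_remainder hw hE0
    (e := fun j => momentLin w (X ^ (n + 1 + j) * recOP w (n + 1))) (fun j => by
      rw [← hEpos]; congr 1; push_cast; ring)
  have key : ∀ k : ℕ, momentLin (momentTilde w) (X ^ k * tildeOP w n) =
      (E / stieltjes w).coeff ((k : ℤ) + 1) := by
    intro k
    rw [← coeff_succ_mul_polyLaurent (coeff_momentTilde w),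
      stieltjesTilde_mul_polyLaurent hw (recOP w (n + 1)), HahnSeries.coeff_add,
      coeff_polyLaurent_of_pos _ (by omega), zero_add]
  refine ⟨fun k hk => ?_, ?_, ?_⟩
  · rw [key, h1 _ (by omega)]
  · rw [key, h2, add_zero, ← hP.sq_eq, recH]
  · rw [key, show (((n + 1 : ℕ) : ℤ) + 1) = (n : ℤ) + 2 by push_cast; ring, h3]
    rw [add_zero, ← hP.sq_eq, momentLin_X_pow_succ_mul_recOP hN, ← recH]
    ring

theorem isMonicOP_tildeOP {w : ℕ → ℂ} {n : ℕ} (hN : ∀ k ≤ n + 1, recH w k ≠ 0) :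
    IsMonicOP (momentTilde w) n (tildeOP w n) := by
  have hw : w 0 ≠ 0 := by
    have := hN 0 (Nat.zero_le _)
    rwa [recH, recOP_zero, one_pow, ← pow_zero X, momentLin_X_pow] at this
  have hd : (tildeOP w n).natDegree = n :=
    natDegree_eq_of_le_of_coeff_ne_zero
      (natDegree_le_iff_coeff_eq_zero.2 fun j hj => coeff_tildeOP_of_lt hw hj)
      (by rw [coeff_tildeOP_self hw]; exact one_ne_zero)
  exact ⟨by rw [Monic, leadingCoeff, hd, coeff_tildeOP_self hw], hd,
    (momentLin_momentTilde hN).1⟩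

theorem momentLin_tildeOP_sq {w : ℕ → ℂ} {n : ℕ} (hN : ∀ k ≤ n + 1, recH w k ≠ 0) :
    momentLin (momentTilde w) (tildeOP w n ^ 2) = recH w (n + 1) / w 0 := by
  rw [(isMonicOP_tildeOP hN).sq_eq, (momentLin_momentTilde hN).2.1]

theorem monicOP_momentTilde {w : ℕ → ℂ} {n : ℕ} (hN : ∀ k ≤ n + 1, recH w k ≠ 0) :
    monicOP (momentTilde w) n = tildeOP w n := by
  have hw : w 0 ≠ 0 := by
    have := hN 0 (Nat.zero_le _)
    rwa [recH, recOP_zero, one_pow, ← pow_zero X, momentLin_X_pow] at this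
  refine monicOP_eq (fun k hk => isMonicOP_tildeOP fun i hi => hN i (by omega)) fun k hk => ?_
  rw [momentLin_tildeOP_sq fun i hi => hN i (by omega)]
  exact div_ne_zero (hN _ (by omega)) hw

theorem sqNorm_momentTilde {w : ℕ → ℂ} {n : ℕ} (hN : ∀ k ≤ n + 1, recH w k ≠ 0) :
    sqNorm (momentTilde w) n = recH w (n + 1) / w 0 := by
  rw [sqNorm, monicOP_momentTilde hN, momentFunctional_eq, momentLin_tildeOP_sq hN]

theorem recGamma_momentTilde {w : ℕ → ℂ} {n : ℕ} (hN : ∀ k ≤ n + 2, recH w k ≠ 0) :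
    recGamma (momentTilde w) (n + 1) = recH w (n + 2) / recH w (n + 1) := by
  have hw : w 0 ≠ 0 := by
    have := hN 0 (Nat.zero_le _)
    rwa [recH, recOP_zero, one_pow, ← pow_zero X, momentLin_X_pow] at this
  rw [recGamma, sqNorm_momentTilde hN, Nat.add_sub_cancel,
    sqNorm_momentTilde fun k hk => hN k (by omega), div_div_div_cancel_right₀ hw]

/-- Both the subleading coefficient of `tildeOP` and the next moment of the remainder contain
`recSub w 1 = -β₀`; the two contributions cancel and leave `βₙ₊₁`. -/
theorem recBeta_momentTilde {w : ℕ → ℂ} {n : ℕ} (hN : ∀ k ≤ n + 1, recH w k ≠ 0) :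
    recBeta (momentTilde w) n = recSub w (n + 1) - recSub w (n + 2) := by
  have hw : w 0 ≠ 0 := by
    have := hN 0 (Nat.zero_le _)
    rwa [recH, recOP_zero, one_pow, ← pow_zero X, momentLin_X_pow] at this
  have hT := isMonicOP_tildeOP hN
  have hd := degree_sub_C_mul_X_pow_lt (q := X * tildeOP w n) (n := n + 1) (by
    have h2 : (X * tildeOP w n).natDegree = n + 1 := by
      rw [natDegree_X_mul hT.1.ne_zero, hT.2.1]
    refine degree_le_natDegree.trans_lt ?_
    rw [h2]; exact_mod_cast (n + 1).lt_succ_self)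
  rw [coeff_X_mul, coeff_tildeOP_self hw, C_1, one_mul] at hd
  have h1 := hT.mul_eq hd
  rw [sub_mul, map_sub, mul_assoc, ← pow_two, coeff_sub, coeff_X_pow, if_neg (by omega),
    sub_zero, coeff_X_mul_tildeOP hw, (momentLin_momentTilde hN).2.2,
    momentLin_tildeOP_sq hN] at h1
  have hne : recH w (n + 1) / w 0 ≠ 0 := div_ne_zero (hN _ le_rfl) hw
  rw [recBeta, sqNorm_momentTilde hN, monicOP_momentTilde hN, momentFunctional_eq,
    div_eq_iff hne]
  linear_combination h1

/-! ### Deformation of the orthogonal polynomials -/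

/-- Every coefficient of the polynomial `P s` is differentiable at `t`, with derivative the
corresponding coefficient of `P'`. -/
def HasCoeffDerivAt (P : ℂ → ℂ[X]) (P' : ℂ[X]) (t : ℂ) : Prop :=
  ∀ i, HasDerivAt (fun s => (P s).coeff i) (P'.coeff i) t

theorem hasCoeffDerivAt_const (p : ℂ[X]) (t : ℂ) : HasCoeffDerivAt (fun _ => p) 0 t :=
  fun i => by simpa using hasDerivAt_const t (p.coeff i)

theorem HasCoeffDerivAt.sub {P Q : ℂ → ℂ[X]} {P' Q' : ℂ[X]} {t : ℂ}
    (hP : HasCoeffDerivAt P P' t) (hQ : HasCoeffDerivAt Q Q' t) :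
    HasCoeffDerivAt (fun s => P s - Q s) (P' - Q') t := fun i => by
  simpa only [coeff_sub] using (hP i).fun_sub (hQ i)

theorem HasCoeffDerivAt.mul {P Q : ℂ → ℂ[X]} {P' Q' : ℂ[X]} {t : ℂ}
    (hP : HasCoeffDerivAt P P' t) (hQ : HasCoeffDerivAt Q Q' t) :
    HasCoeffDerivAt (fun s => P s * Q s) (P' * Q t + P t * Q') t := fun i => by
  simp only [coeff_add, coeff_mul, ← Finset.sum_add_distrib]
  exact HasDerivAt.fun_sum fun x _ => (hP x.1).fun_mul (hQ x.2)

theorem hasCoeffDerivAt_C {c : ℂ → ℂ} {c' t : ℂ} (hc : HasDerivAt c c' t) :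
    HasCoeffDerivAt (fun s => C (c s)) (C c') t := fun i => by
  simp only [coeff_C]
  split_ifs
  exacts [hc, hasDerivAt_const _ _]

theorem HasCoeffDerivAt.hasDerivAt_momentLin {w : ℂ → ℕ → ℂ} {w' : ℕ → ℂ} {t : ℂ}
    (hw : ∀ n, HasDerivAt (fun s => w s n) (w' n) t) {P : ℂ → ℂ[X]} {P' : ℂ[X]} {N : ℕ}
    (hP : HasCoeffDerivAt P P' t) (hN : ∀ s, (P s).natDegree ≤ N) :
    HasDerivAt (fun s => momentLin (w s) (P s)) (momentLin (w t) P' + momentLin w' (P t)) t := by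
  set M := max N P'.natDegree + 1 with hM
  have h1 : ∀ s, (P s).natDegree < M := fun s => by have := hN s; omega
  have h2 : P'.natDegree < M := by omega
  simp only [fun s => momentLin_eq_sum_range (w s) (h1 s), momentLin_eq_sum_range (w t) h2,
    momentLin_eq_sum_range w' (h1 t), ← Finset.sum_add_distrib]
  exact HasDerivAt.fun_sum fun i _ => (hP i).fun_mul (hw i)

theorem natDegree_recOP_mul_le (w : ℕ → ℂ) (m n : ℕ) :
    (recOP w m * recOP w n).natDegree ≤ m + n := by
  refine natDegree_mul_le.trans_eq ?_
  rw [(recOP_monic_natDegree w m).2, (recOP_monic_natDegree w n).2]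

theorem HasCoeffDerivAt.hasDerivAt_recH {w : ℂ → ℕ → ℂ} {w' : ℕ → ℂ} {t : ℂ}
    (hw : ∀ n, HasDerivAt (fun s => w s n) (w' n) t) {n : ℕ} {P' : ℂ[X]}
    (hP : HasCoeffDerivAt (fun s => recOP (w s) n) P' t) :
    HasDerivAt (fun s => recH (w s) n)
      (momentLin (w t) (P' * recOP (w t) n + recOP (w t) n * P')
        + momentLin w' (recOP (w t) n * recOP (w t) n)) t := by
  simp only [recH, pow_two]
  exact (hP.mul hP).hasDerivAt_momentLin hw fun s => natDegree_recOP_mul_le _ _ _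

theorem HasCoeffDerivAt.differentiableAt_recB {w : ℂ → ℕ → ℂ} {w' : ℕ → ℂ} {t : ℂ}
    (hw : ∀ n, HasDerivAt (fun s => w s n) (w' n) t) {n : ℕ} {P' : ℂ[X]}
    (hP : HasCoeffDerivAt (fun s => recOP (w s) n) P' t) (h0 : recH (w t) n ≠ 0) :
    DifferentiableAt ℂ (fun s => recB (w s) n) t := by
  refine DifferentiableAt.fun_div ?_ (hP.hasDerivAt_recH hw).differentiableAt h0
  simp only [pow_two]
  refine (((hasCoeffDerivAt_const X t).mul (hP.mul hP)).hasDerivAt_momentLin hw (N := 1 + (n + n))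
    fun s => ?_).differentiableAt
  refine natDegree_mul_le.trans (Nat.add_le_add natDegree_X_le (natDegree_recOP_mul_le _ _ _))

/-- The coefficients are rational in the moments, with norms that do not vanish at `t` as
denominators. -/
theorem exists_hasCoeffDerivAt_recOP {w : ℂ → ℕ → ℂ} {w' : ℕ → ℂ} {t : ℂ}
    (hw : ∀ n, HasDerivAt (fun s => w s n) (w' n) t) (h0 : ∀ k, recH (w t) k ≠ 0) (n : ℕ) :
    ∃ P', HasCoeffDerivAt (fun s => recOP (w s) n) P' t := by
  induction n using Nat.twoStepInduction with
  | zero => simp only [recOP_zero]; exact ⟨0, hasCoeffDerivAt_const _ _⟩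
  | one =>
    simp only [recOP_one]
    have hP : HasCoeffDerivAt (fun s => recOP (w s) 0) 0 t := by
      simp only [recOP_zero]; exact hasCoeffDerivAt_const _ _
    exact ⟨_, ((hasCoeffDerivAt_const X t).sub (hasCoeffDerivAt_C (hP.differentiableAt_recB hw (h0 0)).hasDerivAt)).mul hP⟩
  | more n ih0 ih1 =>
    obtain ⟨P0, hP0⟩ := ih0
    obtain ⟨P1, hP1⟩ := ih1
    simp only [recOP_add_two]
    have hg := (hP1.hasDerivAt_recH hw).fun_div (hP0.hasDerivAt_recH hw) (h0 n)
    exact ⟨_, (((hasCoeffDerivAt_const X t).sub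
      (hasCoeffDerivAt_C (hP1.differentiableAt_recB hw (h0 _)).hasDerivAt)).mul hP1).sub ((hasCoeffDerivAt_C hg).mul hP0)⟩

/-- The leading coefficient is constantly `1`, so differentiation lowers the degree and
orthogonality annihilates the derivative. -/
theorem HasCoeffDerivAt.degree_lt_of_recOP {w : ℂ → ℕ → ℂ} {t : ℂ} {n : ℕ} {P' : ℂ[X]}
    (hP : HasCoeffDerivAt (fun s => recOP (w s) n) P' t) : P'.degree < n := by
  rw [degree_lt_iff_coeff_zero]
  intro m hm
  refine (hP m).unique ?_
  rcases hm.eq_or_lt with rfl | h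
  · simp only [recOP_coeff_self]; exact hasDerivAt_const _ _
  · simp only [recOP_coeff_of_lt _ h]; exact hasDerivAt_const _ _

theorem continuousAt_recH {w : ℂ → ℕ → ℂ} {w' : ℕ → ℂ} {t : ℂ}
    (hw : ∀ n, HasDerivAt (fun s => w s n) (w' n) t) (h0 : ∀ k, recH (w t) k ≠ 0) (n : ℕ) :
    ContinuousAt (fun s => recH (w s) n) t := by
  obtain ⟨P', hP⟩ := exists_hasCoeffDerivAt_recOP hw h0 n
  exact (hP.hasDerivAt_recH hw).continuousAt

theorem eventually_recH_ne_zero {w : ℂ → ℕ → ℂ} {w' : ℕ → ℂ} {t : ℂ}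
    (hw : ∀ n, HasDerivAt (fun s => w s n) (w' n) t) (h0 : ∀ k, recH (w t) k ≠ 0) (N : ℕ) :
    ∀ᶠ s in nhds t, ∀ k ≤ N, recH (w s) k ≠ 0 := by
  refine (Set.finite_Iic N).eventually_all.2 fun k _ => ?_
  exact (continuousAt_recH hw h0 k).eventually_ne (h0 k)

/-- Pairing of a polynomial of degree at most `n + 2` with `P_n`. -/
theorem momentLin_mul_recOP {w : ℕ → ℂ} (h0 : ∀ k, recH w k ≠ 0) {n : ℕ} {q : ℂ[X]}
    (hq : q.degree < (n + 3 : ℕ)) :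
    momentLin w (q * recOP w n) = (q.coeff n - q.coeff (n + 2) * (recOP w (n + 2)).coeff n
      - (q.coeff (n + 1) - q.coeff (n + 2) * recSub w (n + 2)) * recSub w (n + 1)) * recH w n := by
  have hP : ∀ k, IsMonicOP w k (recOP w k) := fun k => isMonicOP_recOP (fun k _ => h0 k) k le_rfl
  set a := q.coeff (n + 1) - q.coeff (n + 2) * recSub w (n + 2) with ha
  -- The subtracted polynomials are orthogonal to `Pₙ`, so the pairing is unchanged while the degree
  -- drops to at most `n`.
  set U := q - C (q.coeff (n + 2)) * recOP w (n + 2) - C a * recOP w (n + 1) with hU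
  have hUd : U.degree < (n + 1 : ℕ) := by
    rw [degree_lt_iff_coeff_zero] at hq ⊢
    intro m hm
    rw [hU, coeff_sub, coeff_sub, coeff_C_mul, coeff_C_mul]
    rcases hm.eq_or_lt with rfl | hm
    · rw [recOP_coeff_self, ha, recSub_succ]; ring
    rcases (Nat.succ_le_of_lt hm).eq_or_lt with rfl | hm
    · rw [recOP_coeff_self, recOP_coeff_of_lt _ (by omega)]; ring
    · rw [hq m hm, recOP_coeff_of_lt _ hm, recOP_coeff_of_lt _ (by omega)]; ring
  have h1 := (hP n).mul_eq hUd
  rw [hU, sub_mul, sub_mul, map_sub, map_sub, mul_assoc, mul_assoc, momentLin_C_mul,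
    momentLin_C_mul, mul_comm (recOP w (n + 2)), mul_comm (recOP w (n + 1)),
    momentLin_mul_eq_zero (hP (n + 2)).orth ((hP n).degree_lt (by omega)),
    momentLin_mul_eq_zero (hP (n + 1)).orth ((hP n).degree_lt (by omega)), ← hU] at h1
  rw [mul_zero, sub_zero, mul_zero, sub_zero] at h1
  rw [h1, hU, coeff_sub, coeff_sub, coeff_C_mul, coeff_C_mul, ← recSub_succ, recH]

/-! ### Evolution of norms and subleading coefficients under the moment flow. -/

/-- The moments evolve by a first order operator in the index. -/
def MomentFlow (S κ T : ℂ) (w w' : ℕ → ℂ) : Prop :=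
  ∀ n : ℕ, T * w' n = (n + 2 + S) * w (n + 1) + (-n + κ) * w n

theorem MomentFlow.functional {S κ T : ℂ} {w w' : ℕ → ℂ} (h : MomentFlow S κ T w w') (p : ℂ[X]) :
    T * momentLin w' p = momentLin w (X * (X - 1) * derivative p) + (2 + S) * momentLin w (X * p)
      + κ * momentLin w p := by
  induction p using Polynomial.induction_on' with
  | add p q hp hq => simp only [map_add, mul_add, hp, hq]; ring
  | monomial i a =>
    rw [derivative_monomial, X_mul_monomial, momentLin_monomial, momentLin_monomial,
      momentLin_monomial]
    have : X * (X - 1) * monomial (i - 1) (a * i)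
        = monomial (i + 1) (a * i) - monomial i (a * i) := by
      rcases i with _ | i
      · simp
      · rw [Nat.add_sub_cancel, mul_sub, mul_one, sub_mul, mul_assoc, X_mul_monomial,
          X_mul_monomial]
    rw [this, map_sub, momentLin_monomial, momentLin_monomial]
    linear_combination a * h i

theorem coeff_flow (P : ℂ[X]) (k : ℕ) :
    (X * (X - 1) * derivative P).coeff (k + 1) = k * P.coeff k - (k + 1) * P.coeff (k + 1) := by
  rw [mul_assoc, coeff_X_mul, sub_mul, one_mul, coeff_sub, coeff_derivative]
  rcases k with _ | k
  · simp
  · rw [coeff_X_mul, coeff_derivative]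
    push_cast
    ring

theorem degree_flow_lt (w : ℕ → ℂ) (n : ℕ) :
    (X * (X - 1) * derivative (recOP w n)).degree < ((n + 2 : ℕ) : WithBot ℕ) := by
  rw [degree_lt_iff_coeff_zero]
  intro m hm
  obtain ⟨m, rfl⟩ : ∃ k, m = k + 1 := ⟨m - 1, by omega⟩
  rw [coeff_flow, recOP_coeff_of_lt _ (by omega), recOP_coeff_of_lt _ (by omega)]
  ring

/-- Since `L(P ∂ₜP) = 0`, the derivative of the norm is `L'(P²)`, and the flow turns it into `2
L(x(x-1)P'P) + (2+S) L(xP²) + κ L(P²)`. -/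
theorem recH_flow {w : ℂ → ℕ → ℂ} {w' : ℕ → ℂ} {t S κ T : ℂ}
    (hw : ∀ n, HasDerivAt (fun s => w s n) (w' n) t) (hfl : MomentFlow S κ T (w t) w')
    (h0 : ∀ k, recH (w t) k ≠ 0) (k : ℕ) :
    ∃ D, HasDerivAt (fun s => recH (w s) (k + 1)) D t ∧
      T * D = recH (w t) (k + 1) * (2 * (k * recSub (w t) (k + 1) - (k + 1)
        - (k + 1) * recSub (w t) (k + 2)) + (2 + S) * recB (w t) (k + 1) + κ) := by
  have hP : IsMonicOP (w t) (k + 1) (recOP (w t) (k + 1)) :=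
    isMonicOP_recOP (fun k _ => h0 k) _ le_rfl
  obtain ⟨P', hP'⟩ := exists_hasCoeffDerivAt_recOP hw h0 (k + 1)
  refine ⟨_, hP'.hasDerivAt_recH hw, ?_⟩
  rw [mul_comm (recOP (w t) (k + 1)) P', map_add,
    momentLin_mul_eq_zero hP.orth hP'.degree_lt_of_recOP, add_zero, zero_add, hfl.functional,
    derivative_mul, mul_comm (recOP (w t) (k + 1)) (derivative _), ← two_mul,
    ← C_ofNat, mul_left_comm, momentLin_C_mul, ← mul_assoc, momentLin_mul_recOP h0
      ((degree_flow_lt _ _).trans (by exact_mod_cast Nat.lt_succ_self _)),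
    coeff_flow, coeff_flow, coeff_flow, recOP_coeff_self,
    recOP_coeff_of_lt (w t) (show k + 1 < k + 1 + 1 by omega),
    recOP_coeff_of_lt (w t) (show k + 1 < k + 2 + 1 by omega), ← recSub_succ, ← pow_two, ← recH]
  have h2 : recB (w t) (k + 1) * recH (w t) (k + 1)
      = momentLin (w t) (X * recOP (w t) (k + 1) ^ 2) := div_mul_cancel₀ _ (h0 _)
  rw [← h2]
  push_cast
  ring

/-- Differentiating `L(Pₖ₊₂ Pₖ₊₁) = 0`, which holds in a neighbourhood of `t`, leaves the top
coefficient of `∂ₜPₖ₊₂` times `hₖ₊₁`, plus `L'(Pₖ₊₂ Pₖ₊₁)`. The `κ` term vanishes by orthogonality.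
-/
theorem recSub_flow {w : ℂ → ℕ → ℂ} {w' : ℕ → ℂ} {t S κ T : ℂ}
    (hw : ∀ n, HasDerivAt (fun s => w s n) (w' n) t) (hfl : MomentFlow S κ T (w t) w')
    (h0 : ∀ k, recH (w t) k ≠ 0) (k : ℕ) :
    ∃ D, HasDerivAt (fun s => recSub (w s) (k + 2)) D t ∧
      T * D = -((2 * k + 5 + S) * (recH (w t) (k + 2) / recH (w t) (k + 1))
        - 2 * (recOP (w t) (k + 2)).coeff k + recSub (w t) (k + 2) + recSub (w t) (k + 2) ^ 2) := by
  have hP : ∀ k, IsMonicOP (w t) k (recOP (w t) k) :=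
    fun k => isMonicOP_recOP (fun k _ => h0 k) _ le_rfl
  obtain ⟨P', hP'⟩ := exists_hasCoeffDerivAt_recOP hw h0 (k + 2)
  obtain ⟨Q', hQ'⟩ := exists_hasCoeffDerivAt_recOP hw h0 (k + 1)
  refine ⟨P'.coeff (k + 1), by simpa only [recSub_succ] using hP' (k + 1), ?_⟩
  have hd := (hP'.mul hQ').hasDerivAt_momentLin hw fun s => natDegree_recOP_mul_le _ _ _
  have hev : (fun s => momentLin (w s) (recOP (w s) (k + 2) * recOP (w s) (k + 1)))
      =ᶠ[nhds t] fun _ => 0 := by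
    filter_upwards [eventually_recH_ne_zero hw h0 (k + 2)] with s hs
    have hP := isMonicOP_recOP (fun i hi => hs i (Nat.le_of_lt hi))
    rw [mul_comm]
    exact momentLin_mul_eq_zero (hP (k + 2) le_rfl).orth ((hP (k + 1) (by omega)).degree_lt (by omega))
  have hz := (hd.congr_of_eventuallyEq hev.symm).unique (hasDerivAt_const t 0)
  have hfl' := hfl.functional (recOP (w t) (k + 2) * recOP (w t) (k + 1))
  have e1 : momentLin (w t) (P' * recOP (w t) (k + 1)) = P'.coeff (k + 1) * recH (w t) (k + 1) :=
    (hP (k + 1)).mul_eq hP'.degree_lt_of_recOP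
  have e2 : momentLin (w t) (recOP (w t) (k + 2) * Q') = 0 := by
    rw [mul_comm]
    exact momentLin_mul_eq_zero (hP (k + 2)).orth (hQ'.degree_lt_of_recOP.trans
      (by exact_mod_cast Nat.lt_succ_self _))
  have e3 : momentLin (w t) (recOP (w t) (k + 2) * recOP (w t) (k + 1)) = 0 := by
    rw [mul_comm]
    exact momentLin_mul_eq_zero (hP (k + 2)).orth ((hP (k + 1)).degree_lt (by omega))
  have e4 : momentLin (w t) (X * (recOP (w t) (k + 2) * recOP (w t) (k + 1)))
      = recH (w t) (k + 2) := by
    rw [mul_comm (recOP (w t) (k + 2)), ← mul_assoc, (hP (k + 2)).mul_eq, coeff_X_mul,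
      recOP_coeff_self, one_mul, recH]
    rw [degree_lt_iff_coeff_zero]
    intro m hm
    obtain ⟨m, rfl⟩ : ∃ k, m = k + 1 := ⟨m - 1, by omega⟩
    rw [coeff_X_mul, recOP_coeff_of_lt _ (by omega)]
  have e5 := momentLin_mul_recOP h0 (n := k + 1) (degree_flow_lt (w t) (k + 2))
  have e6 : momentLin (w t) (X * (X - 1) * derivative (recOP (w t) (k + 1)) * recOP (w t) (k + 2))
      = (k + 1) * recH (w t) (k + 2) := by
    rw [(hP (k + 2)).mul_eq (degree_flow_lt (w t) (k + 1)), coeff_flow, recOP_coeff_self,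
      recOP_coeff_of_lt _ (by omega), recH]
    push_cast
    ring
  have e7 : X * (X - 1) * derivative (recOP (w t) (k + 2) * recOP (w t) (k + 1))
      = X * (X - 1) * derivative (recOP (w t) (k + 2)) * recOP (w t) (k + 1)
      + X * (X - 1) * derivative (recOP (w t) (k + 1)) * recOP (w t) (k + 2) := by
    rw [derivative_mul]; ring
  rw [coeff_flow, coeff_flow, coeff_flow, recOP_coeff_self,
    recOP_coeff_of_lt (w t) (show k + 2 < k + 2 + 1 by omega), recOP_coeff_sub_two, ← recSub_succ, recB_eq] at e5
  rw [e7, map_add, e6, e5, e4, e3] at hfl'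
  rw [map_add, e1, e2] at hz
  have hne := h0 (k + 1)
  refine mul_right_cancel₀ hne ?_
  field_simp at hfl' ⊢
  push_cast at hfl'
  linear_combination T * hz - hfl'

theorem hasDerivAt_recSub_sub {w : ℂ → ℕ → ℂ} {w' : ℕ → ℂ} {t S κ T : ℂ}
    (hw : ∀ n, HasDerivAt (fun s => w s n) (w' n) t) (hfl : MomentFlow S κ T (w t) w')
    (h0 : ∀ k, recH (w t) k ≠ 0) (k : ℕ) {b : ℂ}
    (hb : b = recSub (w t) (k + 2) - recSub (w t) (k + 3)) :
    ∃ D, HasDerivAt (fun s => recSub (w s) (k + 2) - recSub (w s) (k + 3)) D t ∧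
      T * D = b * (b - 1) + (2 * k + 7 + S) * (recH (w t) (k + 3) / recH (w t) (k + 2))
        - (2 * k + 3 + S) * (recH (w t) (k + 2) / recH (w t) (k + 1)) := by
  obtain ⟨D1, hD1, e1⟩ := recSub_flow hw hfl h0 k
  obtain ⟨D2, hD2, e2⟩ := recSub_flow hw hfl h0 (k + 1)
  refine ⟨D1 - D2, hD1.fun_sub hD2, ?_⟩
  rw [recOP_coeff_sub_two, recB_eq] at e2
  push_cast at e2
  subst hb
  linear_combination e1 - e2

/-- The logarithmic derivative of a quotient of norms is a difference of two instances of
`recH_flow`, in which `κ` cancels. -/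
theorem hasDerivAt_recH_div {w : ℂ → ℕ → ℂ} {w' : ℕ → ℂ} {t S κ T : ℂ}
    (hw : ∀ n, HasDerivAt (fun s => w s n) (w' n) t) (hfl : MomentFlow S κ T (w t) w')
    (h0 : ∀ k, recH (w t) k ≠ 0) (k : ℕ) :
    ∃ D, HasDerivAt (fun s => recH (w s) (k + 2) / recH (w s) (k + 1)) D t ∧
      T * (D / (recH (w t) (k + 2) / recH (w t) (k + 1))) =
        -2 + (2 * k + 6 + S) * (recSub (w t) (k + 2) - recSub (w t) (k + 3))
          - (2 * k + 2 + S) * (recSub (w t) (k + 1) - recSub (w t) (k + 2)) := by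
  obtain ⟨D1, hD1, e1⟩ := recH_flow hw hfl h0 k
  obtain ⟨D2, hD2, e2⟩ := recH_flow hw hfl h0 (k + 1)
  refine ⟨_, hD2.fun_div hD1 (h0 _), ?_⟩
  have n1 := h0 (k + 1)
  have n2 := h0 (k + 2)
  rw [recB_eq] at e1 e2
  push_cast at e2
  field_simp
  linear_combination recH (w t) (k + 1) * e2 - recH (w t) (k + 2) * e1

open Filter Topology Set MeasureTheory

/-! ### Continuous branches of the logarithm -/

/-- Locally, a continuous logarithm is obtained from the principal one by translation. -/
theorem eventually_eq_add_log {X : Type*} [TopologicalSpace X] {f g : X → ℂ} {x : X}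
    (hf : ContinuousAt f x) (hfg : ∀ᶠ y in 𝓝 x, Complex.exp (f y) = g y) :
    ∀ᶠ y in 𝓝 x, f y = f x + Complex.log (g y / g x) := by
  -- Near `x` the increment of `f` has imaginary part in `(-π, π)`, where the principal logarithm
  -- inverts the exponential.
  have h0 : Tendsto (fun y => (f y - f x).im) (𝓝 x) (𝓝 0) := by
    have : ContinuousAt (fun y => (f y - f x).im) x := by fun_prop
    simpa [ContinuousAt] using this
  filter_upwards [hfg, h0.eventually_const_lt (neg_lt_zero.2 Real.pi_pos),
    h0.eventually_lt_const Real.pi_pos] with y hy h1 h2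
  rw [← hy, ← hfg.self_of_nhds, ← Complex.exp_sub, Complex.log_exp h1 h2.le]
  ring

theorem hasDerivAt_of_exp_eq {f g : ℂ → ℂ} {g' x : ℂ} (hf : ContinuousAt f x)
    (hfg : ∀ᶠ y in 𝓝 x, Complex.exp (f y) = g y) (hg : HasDerivAt g g' x) :
    HasDerivAt f (g' / g x) x := by
  have h0 : g x ≠ 0 := by rw [← hfg.self_of_nhds]; exact Complex.exp_ne_zero _
  have h1 : HasDerivAt (fun y => f x + Complex.log (g y / g x)) (g' / g x / (g x / g x)) x :=
    ((hg.div_const _).clog (by rw [div_self h0]; exact Complex.one_mem_slitPlane)).const_add _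
  rw [div_self h0, div_one] at h1
  exact h1.congr_of_eventuallyEq (eventually_eq_add_log hf hfg)

theorem hasDerivAt_real_of_exp_eq {f g : ℝ → ℂ} {g' : ℂ} {x : ℝ} (hf : ContinuousAt f x)
    (hfg : ∀ᶠ y in 𝓝 x, Complex.exp (f y) = g y) (hg : HasDerivAt g g' x) :
    HasDerivAt f (g' / g x) x := by
  have h0 : g x ≠ 0 := by rw [← hfg.self_of_nhds]; exact Complex.exp_ne_zero _
  have h1 : HasDerivAt (fun y => f x + Complex.log (g y / g x)) (g' / g x / (g x / g x)) x :=
    ((hg.div_const _).clog_real (by rw [div_self h0]; exact Complex.one_mem_slitPlane)).const_add _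
  rw [div_self h0, div_one] at h1
  exact h1.congr_of_eventuallyEq (eventually_eq_add_log hf hfg)

/-- A continuous logarithm on a preconnected set of a function with values near `1` is bounded. -/
theorem exists_norm_le_of_exp_mem {X : Type*} [TopologicalSpace X] {S : Set X} {H : X → ℂ} {c : ℂ}
    (hS : IsPreconnected S) (hc : c ≠ 0) (hH : ContinuousOn H S)
    (h1 : ∀ p ∈ S, Complex.exp (H p) / c ∈ Complex.slitPlane)
    (h2 : ∀ p ∈ S, ‖Complex.log (Complex.exp (H p) / c)‖ ≤ 1) :
    ∃ C, ∀ p ∈ S, ‖H p‖ ≤ C := by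
  rcases S.eq_empty_or_nonempty with rfl | ⟨p0, hp0⟩
  · exact ⟨0, fun p hp => hp.elim⟩
  -- This compares `H` with a principal branch; the difference is continuous with values in `2πiℤ`,
  -- hence constant on a preconnected set.
  set g : X → ℂ := fun p => H p - Complex.log (Complex.exp (H p) / c) - Complex.log c with hg
  have hgc : ContinuousOn g S := by
    refine (hH.sub (ContinuousOn.clog ?_ h1)).sub continuousOn_const
    exact (Complex.continuous_exp.comp_continuousOn hH).div_const _
  have hge : ∀ p, ∃ n : ℤ, g p = n * (2 * Real.pi * Complex.I) := by
    intro p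
    rw [← Complex.exp_eq_one_iff, hg]
    dsimp only
    rw [Complex.exp_sub, Complex.exp_sub, Complex.exp_log (div_ne_zero (Complex.exp_ne_zero _) hc),
      Complex.exp_log hc, div_div_cancel₀ (Complex.exp_ne_zero _), div_self hc]
  have hd : DiscreteTopology (range ((↑) : ℤ → ℝ)) :=
    Int.isClosedEmbedding_coe_real.isEmbedding.toHomeomorph.symm.isEmbedding.discreteTopology
  have hconst : ∀ p ∈ S, g p = g p0 := by
    intro p hp
    have him : (g p).im / (2 * Real.pi) = (g p0).im / (2 * Real.pi) := by
      refine hS.constant_of_mapsTo (T := range ((↑) : ℤ → ℝ))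
        (isDiscrete_iff_discreteTopology.2 hd) (f := fun p => (g p).im / (2 * Real.pi)) ?_ ?_ hp hp0
      · exact (Complex.continuous_im.comp_continuousOn hgc).div_const _
      · intro q _
        obtain ⟨n, hn⟩ := hge q
        refine ⟨n, ?_⟩
        have : (g q).im = n * (2 * Real.pi) := by rw [hn]; simp
        dsimp only
        rw [this]
        field_simp
    obtain ⟨n, hn⟩ := hge p
    obtain ⟨m, hm⟩ := hge p0
    have hpi := Real.pi_pos
    rw [div_left_inj' (by positivity)] at him
    apply Complex.ext
    · rw [hn, hm]; simp
    · exact him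
  refine ⟨‖g p0‖ + ‖Complex.log c‖ + 1, fun p hp => ?_⟩
  have e : H p = g p0 + Complex.log c + Complex.log (Complex.exp (H p) / c) := by
    rw [← hconst p hp, hg]; ring
  calc ‖H p‖ = ‖g p0 + Complex.log c + Complex.log (Complex.exp (H p) / c)‖ := by rw [← e]
    _ ≤ ‖g p0‖ + ‖Complex.log c‖ + ‖Complex.log (Complex.exp (H p) / c)‖ := norm_add₃_le
    _ ≤ _ := by have := h2 p hp; linarith

/-- The point `(t₀, 0)` lies on the boundary of the domain, so connectedness is taken from a product
of a ball and an interval. The bound controls the argument too, which matters for nonreal exponents.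
-/
theorem exists_eventually_norm_log_le {U : Set ℂ} {t₀ : ℂ} (hU : IsOpen U) (ht : t₀ ∈ U)
    {H : ℂ × ℝ → ℂ} {c : ℂ} (hc : c ≠ 0) (hH : ContinuousOn H (U ×ˢ Ioo 0 1))
    (hlim : Tendsto (fun p => Complex.exp (H p)) (𝓝[U ×ˢ Ioo 0 1] (t₀, 0)) (𝓝 c)) :
    ∃ C, ∀ᶠ p in 𝓝[U ×ˢ Ioo 0 1] (t₀, (0 : ℝ)), ‖H p‖ ≤ C := by
  have hl : Tendsto (fun p => Complex.exp (H p) / c) (𝓝[U ×ˢ Ioo 0 1] (t₀, 0)) (𝓝 1) := by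
    simpa [div_self hc] using hlim.div_const c
  have e1 := hl.eventually (Complex.isOpen_slitPlane.mem_nhds Complex.one_mem_slitPlane)
  have e2 : ∀ᶠ p in 𝓝[U ×ˢ Ioo 0 1] (t₀, (0 : ℝ)), ‖Complex.log (Complex.exp (H p) / c)‖ ≤ 1 := by
    have : Tendsto (fun z => ‖Complex.log z‖) (𝓝 1) (𝓝 0) := by
      have := (continuousAt_clog Complex.one_mem_slitPlane).norm
      simpa [ContinuousAt] using this
    filter_upwards [(this.comp hl).eventually_le_const one_pos] with p hp using hp
  have e3 := e1.and e2
  rw [eventually_nhdsWithin_iff, Metric.eventually_nhds_iff_ball] at e3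
  obtain ⟨ε, hε, hball⟩ := e3
  obtain ⟨r, hr, hrU⟩ := Metric.isOpen_iff.1 hU t₀ ht
  set δ := min (min ε r) 1 with hδ
  have hδ0 : 0 < δ := by positivity
  set S : Set (ℂ × ℝ) := Metric.ball t₀ δ ×ˢ Ioo 0 δ with hS
  have hsub : S ⊆ U ×ˢ Ioo 0 1 := by
    rintro ⟨t, s⟩ ⟨h1, h2⟩
    refine ⟨hrU (Metric.ball_subset_ball ((min_le_left _ _).trans (min_le_right _ _)) h1), h2.1,
      h2.2.trans_le (min_le_right _ _)⟩
  have hsub' : S ⊆ Metric.ball (t₀, (0 : ℝ)) ε := by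
    rintro ⟨t, s⟩ ⟨h1, h2⟩
    rw [← ball_prod_same]
    have hδε : δ ≤ ε := (min_le_left _ _).trans (min_le_left _ _)
    refine ⟨Metric.ball_subset_ball hδε h1, ?_⟩
    rw [Metric.mem_ball, Real.dist_eq, sub_zero, abs_of_pos h2.1]
    exact h2.2.trans_le hδε
  obtain ⟨C, hC⟩ := exists_norm_le_of_exp_mem (S := S)
    ((convex_ball t₀ δ).prod (convex_Ioo 0 δ)).isPreconnected hc
    (hH.mono hsub) (fun p hp => (hball p (hsub' hp) (hsub hp)).1)
    (fun p hp => (hball p (hsub' hp) (hsub hp)).2)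
  refine ⟨C, ?_⟩
  rw [eventually_nhdsWithin_iff, Metric.eventually_nhds_iff_ball]
  refine ⟨δ, hδ0, fun p hp hpU => hC p ?_⟩
  obtain ⟨t, s⟩ := p
  rw [← ball_prod_same] at hp
  refine ⟨hp.1, hpU.2.1, ?_⟩
  have := hp.2
  rw [Metric.mem_ball, Real.dist_eq, sub_zero] at this
  exact (le_abs_self s).trans_lt this

/-! ### The weight along an arc -/

variable {α β μ : ℂ} {U : Set ℂ}

/-- The sign `ε` for which the weight has the factor `(ε (x - e)) ^ expo e`. -/
def SingPt.sgn : SingPt → ℂ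
  | .zero => 1
  | .one => -1
  | .tee => 1

/-- The velocity of a singular point as a function of `t`. -/
def SingPt.vel : SingPt → ℂ
  | .zero => 0
  | .one => 0
  | .tee => 1

theorem SingPt.sgn_ne_zero (e : SingPt) : e.sgn ≠ 0 := by cases e <;> simp [SingPt.sgn]

theorem SingPt.hasDerivAt_pos (e : SingPt) (t : ℂ) : HasDerivAt (fun t => e.pos t) e.vel t := by
  cases e
  · exact hasDerivAt_const t 0
  · exact hasDerivAt_const t 1
  · exact hasDerivAt_id t

theorem SingPt.pos_injective {t : ℂ} (h0 : t ≠ 0) (h1 : t ≠ 1) :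
    Function.Injective (SingPt.pos t) := by
  intro a b h
  cases a <;> cases b <;> simp_all [SingPt.pos, eq_comm]

/-- The branch of `log (ε (x - e))` along the arc. -/
def JacobiArc.logAt (Γ : JacobiArc α β μ U) : SingPt → ℂ × ℝ → ℂ
  | .zero => fun p => Γ.logX p.1 p.2
  | .one => fun p => Γ.logOneSub p.1 p.2
  | .tee => fun p => Γ.logSubT p.1 p.2

theorem JacobiArc.continuousOn_logAt (Γ : JacobiArc α β μ U) (e : SingPt) :
    ContinuousOn (Γ.logAt e) (U ×ˢ Ioo 0 1) := by
  cases e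
  exacts [Γ.continuousOn_logX, Γ.continuousOn_logOneSub, Γ.continuousOn_logSubT]

theorem JacobiArc.exp_logAt (Γ : JacobiArc α β μ U) (e : SingPt) {t : ℂ} (ht : t ∈ U) {s : ℝ}
    (hs : s ∈ Ioo (0 : ℝ) 1) :
    Complex.exp (Γ.logAt e (t, s)) = e.sgn * (Γ.path t s - e.pos t) := by
  cases e
  · simpa [logAt, SingPt.sgn, SingPt.pos] using Γ.exp_logX t ht s hs
  · simpa [logAt, SingPt.sgn, SingPt.pos] using Γ.exp_logOneSub t ht s hs
  · simpa [logAt, SingPt.sgn, SingPt.pos] using Γ.exp_logSubT t ht s hs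

theorem JacobiArc.weight_eq (Γ : JacobiArc α β μ U) (t : ℂ) (s : ℝ) :
    Γ.weight t s = Γ.coef * Complex.exp (α * Γ.logAt .zero (t, s) + β * Γ.logAt .one (t, s)
      + μ * Γ.logAt .tee (t, s)) := rfl

/-- The arc as a function of both variables. -/
def JacobiArc.map (Γ : JacobiArc α β μ U) (p : ℂ × ℝ) : ℂ := Γ.path p.1 p.2

theorem JacobiArc.contDiffAt_map (Γ : JacobiArc α β μ U) (hU : IsOpen U) {t : ℂ} (ht : t ∈ U)
    (s : ℝ) : ContDiffAt ℝ 2 Γ.map (t, s) :=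
  Γ.contDiffOn_path.contDiffAt ((hU.prod isOpen_univ).mem_nhds ⟨ht, mem_univ _⟩)

theorem JacobiArc.hasFDerivAt_map (Γ : JacobiArc α β μ U) (hU : IsOpen U) {t : ℂ} (ht : t ∈ U)
    (s : ℝ) : HasFDerivAt Γ.map (fderiv ℝ Γ.map (t, s)) (t, s) :=
  ((Γ.contDiffAt_map hU ht s).differentiableAt (by norm_num)).hasFDerivAt

theorem JacobiArc.hasDerivAt_path (Γ : JacobiArc α β μ U) (hU : IsOpen U) {t : ℂ} (ht : t ∈ U)
    (s : ℝ) : HasDerivAt (Γ.path t) (fderiv ℝ Γ.map (t, s) (0, 1)) s := by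
  have h := (Γ.hasFDerivAt_map hU ht s).comp_hasDerivAt s
    ((hasDerivAt_const s t).prodMk (hasDerivAt_id s))
  exact h

theorem JacobiArc.deriv_path_eq (Γ : JacobiArc α β μ U) (hU : IsOpen U) {t : ℂ} (ht : t ∈ U)
    (s : ℝ) : deriv (Γ.path t) s = fderiv ℝ Γ.map (t, s) (0, 1) :=
  (Γ.hasDerivAt_path hU ht s).deriv

/-- Strict differentiability at `(t₀, 0)` makes the convergence joint in `t` and `s`, as uniform
bounds in `t` require. -/
theorem JacobiArc.tendsto_slope (Γ : JacobiArc α β μ U) (hU : IsOpen U) {t₀ : ℂ} (ht : t₀ ∈ U) :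
    Tendsto (fun p : ℂ × ℝ => (Γ.path p.1 p.2 - Γ.src.pos p.1) / p.2) (𝓝[U ×ˢ Ioo 0 1] (t₀, 0))
      (𝓝 (deriv (Γ.path t₀) 0)) := by
  have hs := (Γ.contDiffAt_map hU ht 0).hasStrictFDerivAt (by norm_num)
  have hq : Tendsto (fun p : ℂ × ℝ => ((p.1, p.2), (p.1, (0 : ℝ)))) (𝓝[U ×ˢ Ioo 0 1] (t₀, 0))
      (𝓝 ((t₀, 0), (t₀, 0))) := by
    refine Tendsto.mono_left ?_ nhdsWithin_le_nhds
    have : Continuous fun p : ℂ × ℝ => ((p.1, p.2), (p.1, (0 : ℝ))) := by fun_prop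
    simpa using this.tendsto (t₀, 0)
  have ho := hs.isLittleO.comp_tendsto hq
  have hb : ((fun p : (ℂ × ℝ) × (ℂ × ℝ) => p.1 - p.2) ∘ fun p : ℂ × ℝ => ((p.1, p.2), (p.1, (0 : ℝ))))
      =O[𝓝[U ×ˢ Ioo 0 1] (t₀, (0 : ℝ))] fun p : ℂ × ℝ => (p.2 : ℂ) :=
    Asymptotics.isBigO_of_le _ fun p => by simp [Prod.norm_def]
  have ho' := (ho.trans_isBigO hb).tendsto_div_nhds_zero
  have h1 := ho'.add_const (deriv (Γ.path t₀) 0)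
  rw [zero_add] at h1
  refine h1.congr' ?_
  filter_upwards [self_mem_nhdsWithin] with p hp
  have hs0 : (p.2 : ℂ) ≠ 0 := Complex.ofReal_ne_zero.2 hp.2.1.ne'
  have e1 : ((p.1, p.2) - (p.1, (0 : ℝ)) : ℂ × ℝ) = p.2 • ((0 : ℂ), (1 : ℝ)) := by ext <;> simp
  simp only [Function.comp_apply]
  rw [e1, map_smul, ← Γ.deriv_path_eq hU ht, ← Γ.path_zero p.1 hp.1, Complex.real_smul]
  simp only [JacobiArc.map]
  field_simp
  ring

open scoped Classical in
/-- Near its initial point, each branch of the logarithm is bounded or asymptotic to `log s`. -/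
theorem JacobiArc.exists_eventually_logAt_le (Γ : JacobiArc α β μ U) (hU : IsOpen U)
    (hU0 : (0 : ℂ) ∉ U) (hU1 : (1 : ℂ) ∉ U) {t₀ : ℂ} (ht : t₀ ∈ U) (e : SingPt) :
    ∃ C, ∀ᶠ p in 𝓝[U ×ˢ Ioo 0 1] (t₀, (0 : ℝ)),
      ‖Γ.logAt e p - (if e = Γ.src then (Real.log p.2 : ℂ) else 0)‖ ≤ C := by
  split_ifs with he
  -- Subtracting `log s` divides `x - e` by `s`; the limit of this slope is the initial velocity,
  -- which is nonzero.
  · refine exists_eventually_norm_log_le hU ht (c := e.sgn * deriv (Γ.path t₀) 0)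
      (mul_ne_zero e.sgn_ne_zero (Γ.deriv_path_zero t₀ ht)) ?_ ?_
    · refine (Γ.continuousOn_logAt e).sub (Complex.continuous_ofReal.comp_continuousOn ?_)
      exact continuousOn_snd.log fun p hp => hp.2.1.ne'
    · refine ((Γ.tendsto_slope hU ht).const_mul e.sgn).congr' ?_
      filter_upwards [self_mem_nhdsWithin] with p hp
      rw [Complex.exp_sub, Γ.exp_logAt e hp.1 hp.2, ← Complex.ofReal_exp, Real.exp_log hp.2.1, he,
        mul_div_assoc]
  · have hne : Γ.src.pos t₀ - e.pos t₀ ≠ 0 := by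
      refine sub_ne_zero.2 fun h => he ?_
      exact (SingPt.pos_injective (fun h => hU0 (h ▸ ht)) (fun h => hU1 (h ▸ ht)) h).symm
    refine exists_eventually_norm_log_le hU ht (c := e.sgn * (Γ.src.pos t₀ - e.pos t₀))
      (mul_ne_zero e.sgn_ne_zero hne) ?_ ?_
    · simpa using Γ.continuousOn_logAt e
    · have h1 : Tendsto (fun p : ℂ × ℝ => e.sgn * (Γ.map p - e.pos p.1)) (𝓝 (t₀, 0))
          (𝓝 (e.sgn * (Γ.src.pos t₀ - e.pos t₀))) := by
        have h2 := (Γ.contDiffAt_map hU ht 0).continuousAt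
        have h3 : ContinuousAt (fun p : ℂ × ℝ => e.pos p.1) (t₀, 0) :=
          ContinuousAt.comp (g := fun t => e.pos t) (e.hasDerivAt_pos t₀).continuousAt
            continuousAt_fst
        have h4 := (h2.sub h3).const_mul e.sgn
        rw [← Γ.path_zero t₀ ht]
        exact h4
      refine (h1.mono_left nhdsWithin_le_nhds).congr' ?_
      filter_upwards [self_mem_nhdsWithin] with p hp
      rw [sub_zero, Γ.exp_logAt e hp.1 hp.2]
      rfl

open scoped Classical in
/-- Near its initial point, the weight is of the order `s ^ Re e`, uniformly in `t`. -/
theorem JacobiArc.exists_eventually_weight_le (Γ : JacobiArc α β μ U) (hU : IsOpen U)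
    (hU0 : (0 : ℂ) ∉ U) (hU1 : (1 : ℂ) ∉ U) {t₀ : ℂ} (ht : t₀ ∈ U) :
    ∃ C, ∀ᶠ p in 𝓝[U ×ˢ Ioo 0 1] (t₀, (0 : ℝ)),
      ‖Γ.weight p.1 p.2‖ ≤ C * p.2 ^ (Γ.src.expo α β μ).re := by
  obtain ⟨C0, h0⟩ := Γ.exists_eventually_logAt_le hU hU0 hU1 ht .zero
  obtain ⟨C1, h1⟩ := Γ.exists_eventually_logAt_le hU hU0 hU1 ht .one
  obtain ⟨C2, h2⟩ := Γ.exists_eventually_logAt_le hU hU0 hU1 ht .tee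
  refine ⟨‖Γ.coef‖ * Real.exp (‖α‖ * C0 + ‖β‖ * C1 + ‖μ‖ * C2), ?_⟩
  filter_upwards [h0, h1, h2, self_mem_nhdsWithin] with p h0 h1 h2 hp
  set a0 := Γ.logAt .zero p - (if SingPt.zero = Γ.src then (Real.log p.2 : ℂ) else 0) with ha0
  set a1 := Γ.logAt .one p - (if SingPt.one = Γ.src then (Real.log p.2 : ℂ) else 0) with ha1
  set a2 := Γ.logAt .tee p - (if SingPt.tee = Γ.src then (Real.log p.2 : ℂ) else 0) with ha2
  have hsum : α * Γ.logAt .zero (p.1, p.2) + β * Γ.logAt .one (p.1, p.2)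
      + μ * Γ.logAt .tee (p.1, p.2)
      = (Γ.src.expo α β μ * Real.log p.2) + (α * a0 + β * a1 + μ * a2) := by
    rw [ha0, ha1, ha2]
    cases Γ.src <;> simp [SingPt.expo] <;> ring
  rw [Γ.weight_eq, hsum, norm_mul, mul_assoc, Complex.norm_exp]
  refine mul_le_mul_of_nonneg_left ?_ (norm_nonneg _)
  rw [Real.rpow_def_of_pos hp.2.1, ← Real.exp_add]
  refine Real.exp_le_exp.2 ?_
  have hre : (α * a0 + β * a1 + μ * a2).re ≤ ‖α‖ * C0 + ‖β‖ * C1 + ‖μ‖ * C2 := by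
    refine (Complex.re_le_norm _).trans (norm_add₃_le.trans ?_)
    rw [norm_mul, norm_mul, norm_mul]
    gcongr
  rw [Complex.add_re, Complex.re_mul_ofReal]
  linarith [mul_comm (Real.log p.2) (Γ.src.expo α β μ).re]

theorem one_sub_mem_Ioo {s : ℝ} (hs : s ∈ Ioo (0 : ℝ) 1) : 1 - s ∈ Ioo (0 : ℝ) 1 :=
  ⟨by linarith [hs.2], by linarith [hs.1]⟩

theorem mapsTo_one_sub (U : Set ℂ) :
    MapsTo (fun p : ℂ × ℝ => (p.1, 1 - p.2)) (U ×ˢ Ioo 0 1) (U ×ˢ Ioo 0 1) :=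
  fun _ hp => ⟨hp.1, one_sub_mem_Ioo hp.2⟩

/-- The arc traversed in the opposite direction. -/
def JacobiArc.reverse (Γ : JacobiArc α β μ U) : JacobiArc α β μ U where
  src := Γ.tgt
  tgt := Γ.src
  path t s := Γ.path t (1 - s)
  contDiffOn_path := Γ.contDiffOn_path.comp (f := fun p : ℂ × ℝ => (p.1, 1 - p.2))
    (contDiff_fst.prodMk (contDiff_const.sub contDiff_snd)).contDiffOn
    fun _ hp => ⟨hp.1, mem_univ _⟩
  differentiableOn_path s hs :=
    Γ.differentiableOn_path (1 - s) ⟨by linarith [hs.2], by linarith [hs.1]⟩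
  path_zero t ht := by simpa using Γ.path_one t ht
  path_one t ht := by simpa using Γ.path_zero t ht
  path_ne t ht s hs := Γ.path_ne t ht (1 - s) (one_sub_mem_Ioo hs)
  deriv_path_zero t ht := by
    rw [deriv_comp_const_sub, sub_zero]
    exact neg_ne_zero.2 (Γ.deriv_path_one t ht)
  deriv_path_one t ht := by
    rw [deriv_comp_const_sub, sub_self]
    exact neg_ne_zero.2 (Γ.deriv_path_zero t ht)
  logX t s := Γ.logX t (1 - s)
  logOneSub t s := Γ.logOneSub t (1 - s)
  logSubT t s := Γ.logSubT t (1 - s)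
  continuousOn_logX := Γ.continuousOn_logX.comp (f := fun p : ℂ × ℝ => (p.1, 1 - p.2))
    (by fun_prop) (mapsTo_one_sub U)
  continuousOn_logOneSub := Γ.continuousOn_logOneSub.comp (f := fun p : ℂ × ℝ => (p.1, 1 - p.2))
    (by fun_prop) (mapsTo_one_sub U)
  continuousOn_logSubT := Γ.continuousOn_logSubT.comp (f := fun p : ℂ × ℝ => (p.1, 1 - p.2))
    (by fun_prop) (mapsTo_one_sub U)
  exp_logX t ht s hs := Γ.exp_logX t ht _ (one_sub_mem_Ioo hs)
  exp_logOneSub t ht s hs := Γ.exp_logOneSub t ht _ (one_sub_mem_Ioo hs)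
  exp_logSubT t ht s hs := Γ.exp_logSubT t ht _ (one_sub_mem_Ioo hs)
  coef := Γ.coef
  src_expo := Γ.tgt_expo
  tgt_expo := Γ.src_expo

theorem JacobiArc.weight_reverse (Γ : JacobiArc α β μ U) (t : ℂ) (s : ℝ) :
    Γ.reverse.weight t s = Γ.weight t (1 - s) := rfl

/-! ### Uniform domination of the weight -/

theorem JacobiArc.continuousOn_weight (Γ : JacobiArc α β μ U) :
    ContinuousOn (fun p : ℂ × ℝ => Γ.weight p.1 p.2) (U ×ˢ Ioo 0 1) := by
  have h0 := Γ.continuousOn_logX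
  have h1 := Γ.continuousOn_logOneSub
  have h2 := Γ.continuousOn_logSubT
  unfold JacobiArc.weight
  fun_prop

theorem JacobiArc.exists_weight_le_near_src (Γ : JacobiArc α β μ U) (hU : IsOpen U)
    (hU0 : (0 : ℂ) ∉ U) (hU1 : (1 : ℂ) ∉ U) {t₀ : ℂ} (ht : t₀ ∈ U) :
    ∃ C ≥ (0 : ℝ), ∃ δ > (0 : ℝ), ∀ t ∈ U, dist t t₀ < δ → ∀ s ∈ Ioo (0 : ℝ) 1, s < δ →
      ‖Γ.weight t s‖ ≤ C * s ^ (Γ.src.expo α β μ).re := by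
  obtain ⟨C, hC⟩ := Γ.exists_eventually_weight_le hU hU0 hU1 ht
  rw [eventually_nhdsWithin_iff, Metric.eventually_nhds_iff_ball] at hC
  obtain ⟨δ, hδ, h⟩ := hC
  refine ⟨max C 0, le_max_right _ _, δ, hδ, fun t htU htd s hs hsd => ?_⟩
  refine (h (t, s) ?_ ⟨htU, hs⟩).trans ?_
  · rw [← ball_prod_same]
    refine ⟨htd, ?_⟩
    rwa [Metric.mem_ball, Real.dist_eq, sub_zero, abs_of_pos hs.1]
  · exact mul_le_mul_of_nonneg_right (le_max_left _ _) (Real.rpow_nonneg hs.1.le _)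

/-- An integrable function on `(0, 1)` of the order of the weight. -/
def JacobiArc.majorant (Γ : JacobiArc α β μ U) (s : ℝ) : ℝ :=
  s ^ (Γ.src.expo α β μ).re + (1 - s) ^ (Γ.tgt.expo α β μ).re + 1

theorem JacobiArc.integrableOn_majorant (Γ : JacobiArc α β μ U) :
    IntegrableOn Γ.majorant (Ioo 0 1) := by
  have h1 : IntervalIntegrable (fun s : ℝ => s ^ (Γ.src.expo α β μ).re) volume 0 1 :=
    intervalIntegral.intervalIntegrable_rpow' Γ.src_expo
  have h2 : IntervalIntegrable (fun s : ℝ => (1 - s) ^ (Γ.tgt.expo α β μ).re) volume 0 1 := by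
    have := (intervalIntegral.intervalIntegrable_rpow' (a := 0) (b := 1) Γ.tgt_expo).comp_sub_left 1
    simpa using this.symm
  have h3 := (h1.add h2).add (intervalIntegrable_const (c := (1 : ℝ)) (μ := volume) (a := 0) (b := 1))
  rw [intervalIntegrable_iff_integrableOn_Ioo_of_le zero_le_one] at h3
  exact h3

theorem JacobiArc.exists_weight_le (Γ : JacobiArc α β μ U) (hU : IsOpen U)
    (hU0 : (0 : ℂ) ∉ U) (hU1 : (1 : ℂ) ∉ U) {t₀ : ℂ} (ht : t₀ ∈ U) :
    ∃ C ≥ (0 : ℝ), ∃ r > (0 : ℝ), Metric.closedBall t₀ r ⊆ U ∧ ∀ t ∈ Metric.closedBall t₀ r,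
      ∀ s ∈ Ioo (0 : ℝ) 1, ‖Γ.weight t s‖ ≤ C * Γ.majorant s := by
  obtain ⟨C0, hC0, δ0, hδ0, h0⟩ := Γ.exists_weight_le_near_src hU hU0 hU1 ht
  -- Reversing the arc turns the estimate at the initial point into one at the final point;
  -- compactness covers the middle.
  obtain ⟨C1, hC1, δ1, hδ1, h1⟩ := Γ.reverse.exists_weight_le_near_src hU hU0 hU1 ht
  obtain ⟨r0, hr0, hr0U⟩ := Metric.isOpen_iff.1 hU t₀ ht
  set r := min (min δ0 δ1) r0 / 2 with hr
  have hrpos : 0 < r := by positivity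
  have hrδ0 : r < δ0 := by
    have := (min_le_left (min δ0 δ1) r0).trans (min_le_left _ _); rw [hr] at *; linarith
  have hrδ1 : r < δ1 := by
    have := (min_le_left (min δ0 δ1) r0).trans (min_le_right _ _); rw [hr] at *; linarith
  have hrr0 : r < r0 := by
    have := min_le_right (min δ0 δ1) r0; rw [hr] at *; linarith
  have hsub : Metric.closedBall t₀ r ⊆ U := (Metric.closedBall_subset_ball hrr0).trans hr0U
  have hK : IsCompact (Metric.closedBall t₀ r ×ˢ Icc (min δ0 (1 / 2)) (1 - min δ1 (1 / 2))) :=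
    (isCompact_closedBall _ _).prod isCompact_Icc
  obtain ⟨C2, hC2⟩ := hK.exists_bound_of_continuousOn (Γ.continuousOn_weight.mono (by
    rintro ⟨t, s⟩ ⟨h1, h2⟩
    refine ⟨hsub h1, lt_of_lt_of_le (by positivity) h2.1, lt_of_le_of_lt h2.2 ?_⟩
    have : 0 < min δ1 (1 / 2) := by positivity
    linarith))
  refine ⟨max (max C0 C1) C2, hC0.le.trans ((le_max_left _ _).trans (le_max_left _ _)), r, hrpos,
    hsub, fun t htr s hs => ?_⟩
  have p0 : 0 ≤ s ^ (Γ.src.expo α β μ).re := Real.rpow_nonneg hs.1.le _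
  have p1 : 0 ≤ (1 - s) ^ (Γ.tgt.expo α β μ).re := Real.rpow_nonneg (by linarith [hs.2]) _
  have q0 : C0 ≤ max (max C0 C1) C2 := (le_max_left _ _).trans (le_max_left _ _)
  have q1 : C1 ≤ max (max C0 C1) C2 := (le_max_right _ _).trans (le_max_left _ _)
  have q2 : C2 ≤ max (max C0 C1) C2 := le_max_right _ _
  have q : 0 ≤ max (max C0 C1) C2 := hC0.le.trans q0
  have htd : dist t t₀ ≤ r := htr
  unfold JacobiArc.majorant
  by_cases c0 : s < δ0
  · refine (h0 t (hsub htr) (htd.trans_lt hrδ0) s hs c0).trans ?_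
    exact mul_le_mul q0 (by linarith) p0 q
  by_cases c1 : 1 - s < δ1
  · have := h1 t (hsub htr) (htd.trans_lt hrδ1) (1 - s) (one_sub_mem_Ioo hs) c1
    rw [Γ.weight_reverse, sub_sub_cancel] at this
    exact this.trans (mul_le_mul q1 (by change (1 - s) ^ (Γ.tgt.expo α β μ).re ≤ _; linarith) p1 q)
  · have := hC2 (t, s) ⟨htr, (min_le_left _ _).trans (not_lt.1 c0), by
      have := (min_le_left δ1 (1 / 2)).trans (not_lt.1 c1); linarith⟩
    calc ‖Γ.weight t s‖ ≤ C2 := this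
      _ ≤ max (max C0 C1) C2 * 1 := by rw [mul_one]; exact q2
      _ ≤ _ := mul_le_mul_of_nonneg_left (by linarith) q

/-! ### Derivatives along an arc and in `t` -/

/-- The derivative of the arc with respect to `t`. -/
def JacobiArc.pathT (Γ : JacobiArc α β μ U) (t : ℂ) (s : ℝ) : ℂ := deriv (fun t => Γ.path t s) t

/-- The mixed second derivative of the arc. -/
def JacobiArc.pathTS (Γ : JacobiArc α β μ U) (t : ℂ) (s : ℝ) : ℂ :=
  fderiv ℝ (fderiv ℝ Γ.map) (t, s) (0, 1) (1, 0)

theorem JacobiArc.hasDerivAt_path_t (Γ : JacobiArc α β μ U) (hU : IsOpen U) {t : ℂ} (ht : t ∈ U)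
    {s : ℝ} (hs : s ∈ Icc (0 : ℝ) 1) : HasDerivAt (fun t => Γ.path t s) (Γ.pathT t s) t :=
  ((Γ.differentiableOn_path s hs).differentiableAt (hU.mem_nhds ht)).hasDerivAt

theorem JacobiArc.fderiv_map_apply (Γ : JacobiArc α β μ U) (hU : IsOpen U) {t : ℂ} (ht : t ∈ U)
    {s : ℝ} (hs : s ∈ Icc (0 : ℝ) 1) (v : ℂ) :
    fderiv ℝ Γ.map (t, s) (v, 0) = v * Γ.pathT t s := by
  have h1 := HasFDerivAt.comp (f := fun t : ℂ => (t, s)) (g := Γ.map) t (Γ.hasFDerivAt_map hU ht s)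
    ((hasFDerivAt_id t).prodMk (hasFDerivAt_const s t))
  have h2 := (Γ.hasDerivAt_path_t hU ht hs).hasFDerivAt.restrictScalars ℝ
  have h3 := congrArg (fun L : ℂ →L[ℝ] ℂ => L v) (h1.unique h2)
  simpa using h3

theorem JacobiArc.pathT_eq (Γ : JacobiArc α β μ U) (hU : IsOpen U) {t : ℂ} (ht : t ∈ U)
    {s : ℝ} (hs : s ∈ Icc (0 : ℝ) 1) : Γ.pathT t s = fderiv ℝ Γ.map (t, s) (1, 0) := by
  rw [Γ.fderiv_map_apply hU ht hs, one_mul]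

theorem JacobiArc.hasFDerivAt_fderiv_map (Γ : JacobiArc α β μ U) (hU : IsOpen U) {t : ℂ}
    (ht : t ∈ U) (s : ℝ) :
    HasFDerivAt (fderiv ℝ Γ.map) (fderiv ℝ (fderiv ℝ Γ.map) (t, s)) (t, s) :=
  (((Γ.contDiffAt_map hU ht s).fderiv_right (m := 1) (by norm_num)).differentiableAt
    (by norm_num)).hasFDerivAt

theorem JacobiArc.hasDerivAt_fderiv_map (Γ : JacobiArc α β μ U) (hU : IsOpen U) {t : ℂ}
    (ht : t ∈ U) (s : ℝ) (v : ℂ × ℝ) :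
    HasDerivAt (fun s => fderiv ℝ Γ.map (t, s) v)
      (fderiv ℝ (fderiv ℝ Γ.map) (t, s) (0, 1) v) s := by
  have h := (Γ.hasFDerivAt_fderiv_map hU ht s).comp_hasDerivAt s
    ((hasDerivAt_const s t).prodMk (hasDerivAt_id s))
  simpa using h.clm_apply (hasDerivAt_const s v)

theorem JacobiArc.hasDerivAt_pathT (Γ : JacobiArc α β μ U) (hU : IsOpen U) {t : ℂ}
    (ht : t ∈ U) {s : ℝ} (hs : s ∈ Ioo (0 : ℝ) 1) :
    HasDerivAt (fun s => Γ.pathT t s) (Γ.pathTS t s) s := by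
  refine (Γ.hasDerivAt_fderiv_map hU ht s (1, 0)).congr_of_eventuallyEq ?_
  filter_upwards [isOpen_Ioo.mem_nhds hs] with s' hs'
  exact Γ.pathT_eq hU ht (Ioo_subset_Icc_self hs')

/-- By symmetry of second derivatives, the real derivative in direction `v` is the `s`-derivative of
`v * pathT`. It is thus complex linear in `v`, so the velocity is holomorphic in `t`. -/
theorem JacobiArc.hasDerivAt_deriv_path (Γ : JacobiArc α β μ U) (hU : IsOpen U) {t : ℂ}
    (ht : t ∈ U) {s : ℝ} (hs : s ∈ Ioo (0 : ℝ) 1) :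
    HasDerivAt (fun t => deriv (Γ.path t) s) (Γ.pathTS t s) t := by
  have h1 : HasFDerivAt (fun t' => fderiv ℝ Γ.map (t', s) (0, 1)) _ t :=
    (((Γ.hasFDerivAt_fderiv_map hU ht s).comp t
      ((hasFDerivAt_id t).prodMk (hasFDerivAt_const s t))).clm_apply (hasFDerivAt_const (0, 1) t))
  have hsymm : IsSymmSndFDerivAt ℝ Γ.map (t, s) :=
    (Γ.contDiffAt_map hU ht s).isSymmSndFDerivAt (by simp)
  have hv : ∀ v : ℂ, fderiv ℝ (fderiv ℝ Γ.map) (t, s) (0, 1) (v, 0) = v * Γ.pathTS t s := by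
    intro v
    refine (Γ.hasDerivAt_fderiv_map hU ht s (v, 0)).unique ?_
    refine ((Γ.hasDerivAt_pathT hU ht hs).const_mul v).congr_of_eventuallyEq ?_
    filter_upwards [isOpen_Ioo.mem_nhds hs] with s' hs'
    exact Γ.fderiv_map_apply hU ht (Ioo_subset_Icc_self hs') v
  have h2 : HasDerivAt (fun t' => fderiv ℝ Γ.map (t', s) (0, 1)) (Γ.pathTS t s) t := by
    refine hasFDerivAt_of_restrictScalars ℝ h1 ?_
    ext v
    simpa using ((hsymm (v, 0) (0, 1)).trans (hv v)).symm
  refine h2.congr_of_eventuallyEq ?_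
  filter_upwards [hU.mem_nhds ht] with t' ht'
  exact Γ.deriv_path_eq hU ht' s

theorem JacobiArc.hasDerivAt_logAt_t (Γ : JacobiArc α β μ U) (hU : IsOpen U) (e : SingPt) {t : ℂ}
    (ht : t ∈ U) {s : ℝ} (hs : s ∈ Ioo (0 : ℝ) 1) :
    HasDerivAt (fun t => Γ.logAt e (t, s)) ((Γ.pathT t s - e.vel) / (Γ.path t s - e.pos t)) t := by
  have hc : ContinuousAt (fun t => Γ.logAt e (t, s)) t :=
    ((Γ.continuousOn_logAt e).continuousAt ((hU.prod isOpen_Ioo).mem_nhds ⟨ht, hs⟩)).comp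
      (f := fun t => (t, s)) (by fun_prop)
  have h := hasDerivAt_of_exp_eq hc (g := fun t => e.sgn * (Γ.path t s - e.pos t)) (by
    filter_upwards [hU.mem_nhds ht] with t' ht' using Γ.exp_logAt e ht' hs)
    (((Γ.hasDerivAt_path_t hU ht (Ioo_subset_Icc_self hs)).sub (e.hasDerivAt_pos t)).const_mul _)
  rwa [mul_div_mul_left _ _ e.sgn_ne_zero] at h

theorem JacobiArc.hasDerivAt_logAt_s (Γ : JacobiArc α β μ U) (hU : IsOpen U) (e : SingPt) {t : ℂ}
    (ht : t ∈ U) {s : ℝ} (hs : s ∈ Ioo (0 : ℝ) 1) :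
    HasDerivAt (fun s => Γ.logAt e (t, s)) (deriv (Γ.path t) s / (Γ.path t s - e.pos t)) s := by
  have hc : ContinuousAt (fun s => Γ.logAt e (t, s)) s :=
    ((Γ.continuousOn_logAt e).continuousAt ((hU.prod isOpen_Ioo).mem_nhds ⟨ht, hs⟩)).comp
      (f := fun s => (t, s)) (by fun_prop)
  have h := hasDerivAt_real_of_exp_eq hc (g := fun s => e.sgn * (Γ.path t s - e.pos t)) (by
    filter_upwards [isOpen_Ioo.mem_nhds hs] with s' hs' using Γ.exp_logAt e ht hs')
    (((Γ.hasDerivAt_path hU ht s).sub_const _).const_mul _)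
  rwa [mul_div_mul_left _ _ e.sgn_ne_zero, ← Γ.deriv_path_eq hU ht] at h

theorem JacobiArc.hasDerivAt_weight_t (Γ : JacobiArc α β μ U) (hU : IsOpen U) {t : ℂ}
    (ht : t ∈ U) {s : ℝ} (hs : s ∈ Ioo (0 : ℝ) 1) :
    HasDerivAt (fun t => Γ.weight t s) (Γ.weight t s * (α * (Γ.pathT t s / Γ.path t s)
      + β * (Γ.pathT t s / (Γ.path t s - 1)) + μ * ((Γ.pathT t s - 1) / (Γ.path t s - t)))) t := by
  have h := (((((Γ.hasDerivAt_logAt_t hU .zero ht hs).const_mul α).add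
    ((Γ.hasDerivAt_logAt_t hU .one ht hs).const_mul β)).add
    ((Γ.hasDerivAt_logAt_t hU .tee ht hs).const_mul μ)).cexp).const_mul Γ.coef
  simp only [SingPt.vel, SingPt.pos, sub_zero, ← mul_assoc] at h
  exact h

theorem JacobiArc.hasDerivAt_weight_s (Γ : JacobiArc α β μ U) (hU : IsOpen U) {t : ℂ}
    (ht : t ∈ U) {s : ℝ} (hs : s ∈ Ioo (0 : ℝ) 1) :
    HasDerivAt (fun s => Γ.weight t s) (Γ.weight t s * (α * (deriv (Γ.path t) s / Γ.path t s)
      + β * (deriv (Γ.path t) s / (Γ.path t s - 1))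
      + μ * (deriv (Γ.path t) s / (Γ.path t s - t)))) s := by
  have h := (((((Γ.hasDerivAt_logAt_s hU .zero ht hs).const_mul α).add
    ((Γ.hasDerivAt_logAt_s hU .one ht hs).const_mul β)).add
    ((Γ.hasDerivAt_logAt_s hU .tee ht hs).const_mul μ)).cexp).const_mul Γ.coef
  simp only [SingPt.pos, sub_zero, ← mul_assoc] at h
  exact h

/-! ### Integration by parts along an arc and differentiation under the integral sign. -/

/-- The integrand of the moment of order `n`. -/
def JacobiArc.integrand (Γ : JacobiArc α β μ U) (n : ℕ) (t : ℂ) (s : ℝ) : ℂ :=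
  Γ.path t s ^ n * Γ.weight t s * deriv (Γ.path t) s

/-- The primitive that relates the `t`-derivative of the integrand to the integrands. -/
def JacobiArc.primitive (Γ : JacobiArc α β μ U) (n : ℕ) (t : ℂ) (s : ℝ) : ℂ :=
  Γ.path t s ^ n * Γ.weight t s * (t * (t - 1) * Γ.pathT t s - Γ.path t s * (Γ.path t s - 1))

theorem JacobiArc.differentiableAt_integrand (Γ : JacobiArc α β μ U) (hU : IsOpen U) (n : ℕ) {t : ℂ}
    (ht : t ∈ U) {s : ℝ} (hs : s ∈ Ioo (0 : ℝ) 1) :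
    DifferentiableAt ℂ (fun t => Γ.integrand n t s) t :=
  ((((Γ.hasDerivAt_path_t hU ht (Ioo_subset_Icc_self hs)).fun_pow n).fun_mul
    (Γ.hasDerivAt_weight_t hU ht hs)).fun_mul (Γ.hasDerivAt_deriv_path hU ht hs)).differentiableAt

/-- The logarithmic derivatives of `w` along `x(x-1)∂ₓ + t(t-1)∂ₜ` have no poles, because `x(x-1) -
t(t-1) = (x-t)(x+t-1)`. Hence only `xⁿw` and `xⁿ⁺¹w` survive. -/
theorem JacobiArc.hasDerivAt_primitive (Γ : JacobiArc α β μ U) (hU : IsOpen U) (n : ℕ) {t : ℂ}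
    (ht : t ∈ U) {s : ℝ} (hs : s ∈ Ioo (0 : ℝ) 1) :
    HasDerivAt (fun s => Γ.primitive n t s)
      (t * (t - 1) * deriv (fun t => Γ.integrand n t s) t
        - ((n + 2 + (α + β + μ)) * Γ.integrand (n + 1) t s
          + (-n + (μ * (t - 1) - 1 - α)) * Γ.integrand n t s)) s := by
  have hG := ((((Γ.hasDerivAt_path_t hU ht (Ioo_subset_Icc_self hs)).fun_pow n).fun_mul
    (Γ.hasDerivAt_weight_t hU ht hs)).fun_mul (Γ.hasDerivAt_deriv_path hU ht hs)).deriv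
  have hp := Γ.hasDerivAt_path hU ht s
  rw [← Γ.deriv_path_eq hU ht] at hp
  have hB := ((hp.fun_pow n).fun_mul (Γ.hasDerivAt_weight_s hU ht hs)).fun_mul
    (((Γ.hasDerivAt_pathT hU ht hs).const_mul (t * (t - 1))).fun_sub
      (hp.fun_mul (hp.sub_const 1)))
  have h0 : Γ.path t s ≠ 0 := Γ.path_ne t ht s hs .zero
  have h1 : Γ.path t s - 1 ≠ 0 := sub_ne_zero.2 (Γ.path_ne t ht s hs .one)
  have h2 : Γ.path t s - t ≠ 0 := sub_ne_zero.2 (Γ.path_ne t ht s hs .tee)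
  have hn : (n : ℂ) * Γ.path t s ^ (n - 1) = n * Γ.path t s ^ n / Γ.path t s := by
    rcases n with _ | n
    · simp
    · rw [Nat.add_sub_cancel, pow_succ]; field_simp
  refine hB.congr_deriv ?_
  unfold JacobiArc.integrand
  rw [hG, hn]
  field_simp
  ring

theorem JacobiArc.tendsto_primitive_zero (Γ : JacobiArc α β μ U) (hU : IsOpen U)
    (hU0 : (0 : ℂ) ∉ U) (hU1 : (1 : ℂ) ∉ U) (n : ℕ) {t : ℂ} (ht : t ∈ U) :
    Tendsto (fun s => Γ.primitive n t s) (𝓝[>] 0) (𝓝 0) := by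
  obtain ⟨C, hC, δ, hδ, h⟩ := Γ.exists_weight_le_near_src hU hU0 hU1 ht
  -- Holomorphy in `t` is available only for `0 ≤ s ≤ 1`; the Fréchet derivative replaces `pathT` so
  -- that `E` is differentiable on both sides of `0`.
  set E : ℝ → ℂ := fun s => t * (t - 1) * fderiv ℝ Γ.map (t, s) (1, 0)
    - Γ.path t s * (Γ.path t s - 1) with hE
  have hp := Γ.hasDerivAt_path hU ht 0
  have hEd : DifferentiableAt ℝ E 0 :=
    (((Γ.hasDerivAt_fderiv_map hU ht 0 (1, 0)).const_mul (t * (t - 1))).fun_sub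
      (hp.fun_mul (hp.sub_const 1))).differentiableAt
  have hT : Γ.pathT t 0 = Γ.src.vel := by
    refine ((Γ.src.hasDerivAt_pos t).congr_of_eventuallyEq ?_).deriv
    filter_upwards [hU.mem_nhds ht] with t' ht' using Γ.path_zero t' ht'
  -- The field fixes `0` and `1` and moves `t` with unit velocity, so `E` vanishes at an end-point.
  -- Then `E = O(s)`, and the primitive is `O(s ^ (Re e + 1))` with a positive exponent.
  have hE0 : E 0 = 0 := by
    rw [hE]
    dsimp only
    rw [← Γ.pathT_eq hU ht (left_mem_Icc.2 zero_le_one), hT, Γ.path_zero t ht]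
    cases Γ.src <;> simp [SingPt.vel, SingPt.pos]
  have hEO : E =O[𝓝 0] fun s : ℝ => s := by
    simpa [hE0] using hEd.isBigO_sub
  obtain ⟨K, hK⟩ := hEO.bound
  have hpc : Tendsto (fun s => ‖Γ.path t s ^ n‖) (𝓝[>] 0) (𝓝 ‖Γ.path t 0 ^ n‖) :=
    ((hp.continuousAt.pow n).norm.tendsto).mono_left nhdsWithin_le_nhds
  have hpow : Tendsto (fun s : ℝ => s ^ ((Γ.src.expo α β μ).re + 1)) (𝓝[>] 0) (𝓝 0) := by
    have hpos : 0 < (Γ.src.expo α β μ).re + 1 := by linarith [Γ.src_expo]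
    have := (Real.continuousAt_rpow_const 0 ((Γ.src.expo α β μ).re + 1) (Or.inr hpos.le)).tendsto
    rw [Real.zero_rpow hpos.ne'] at this
    exact this.mono_left nhdsWithin_le_nhds
  have hlim := (hpc.mul_const (C * K)).mul hpow
  rw [mul_zero] at hlim
  refine squeeze_zero_norm' ?_ hlim
  filter_upwards [self_mem_nhdsWithin, nhdsWithin_le_nhds (Iio_mem_nhds hδ),
    nhdsWithin_le_nhds (Iio_mem_nhds one_pos), nhdsWithin_le_nhds hK] with s h0 hsδ hs1 hKs
  have hs : s ∈ Ioo (0 : ℝ) 1 := ⟨h0, hs1⟩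
  have hEs : Γ.primitive n t s = Γ.path t s ^ n * Γ.weight t s * E s := by
    rw [JacobiArc.primitive, Γ.pathT_eq hU ht (Ioo_subset_Icc_self hs)]
  have hw := h t ht (by simpa using hδ) s hs hsδ
  rw [Real.norm_of_nonneg hs.1.le] at hKs
  rw [hEs, norm_mul, norm_mul, mul_assoc, mul_assoc]
  refine mul_le_mul_of_nonneg_left ?_ (norm_nonneg _)
  calc ‖Γ.weight t s‖ * ‖E s‖ ≤ (C * s ^ (Γ.src.expo α β μ).re) * (K * s) :=
        mul_le_mul hw hKs (norm_nonneg _) (mul_nonneg hC (Real.rpow_nonneg hs.1.le _))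
    _ = C * K * s ^ ((Γ.src.expo α β μ).re + 1) := by
        rw [Real.rpow_add_one hs.1.ne']; ring

theorem JacobiArc.tendsto_primitive_one (Γ : JacobiArc α β μ U) (hU : IsOpen U)
    (hU0 : (0 : ℂ) ∉ U) (hU1 : (1 : ℂ) ∉ U) (n : ℕ) {t : ℂ} (ht : t ∈ U) :
    Tendsto (fun s => Γ.primitive n t s) (𝓝[<] 1) (𝓝 0) := by
  have h := Γ.reverse.tendsto_primitive_zero hU hU0 hU1 n ht
  have h1 : Tendsto (fun s : ℝ => 1 - s) (𝓝[<] 1) (𝓝[>] 0) := by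
    refine tendsto_nhdsWithin_of_tendsto_nhds_of_eventually_within _ ?_ ?_
    · have : Continuous fun s : ℝ => 1 - s := by fun_prop
      simpa using (this.tendsto 1).mono_left nhdsWithin_le_nhds
    · filter_upwards [self_mem_nhdsWithin] with s hs
      exact sub_pos.2 (mem_Iio.1 hs)
  have hrev : ∀ s, Γ.reverse.primitive n t s = Γ.primitive n t (1 - s) := fun _ => rfl
  refine (h.comp h1).congr fun s => ?_
  rw [Function.comp_apply, hrev, sub_sub_cancel]

theorem JacobiArc.continuousOn_deriv_path (Γ : JacobiArc α β μ U) (hU : IsOpen U) :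
    ContinuousOn (fun p : ℂ × ℝ => deriv (Γ.path p.1) p.2) (U ×ˢ univ) := by
  have h : ContinuousOn (fun p : ℂ × ℝ => fderiv ℝ Γ.map p (0, 1)) (U ×ˢ univ) :=
    (Γ.contDiffOn_path.continuousOn_fderiv_of_isOpen (hU.prod isOpen_univ) (by norm_num)).clm_apply
      continuousOn_const
  exact h.congr fun p hp => Γ.deriv_path_eq hU hp.1 p.2

theorem JacobiArc.continuousOn_integrand (Γ : JacobiArc α β μ U) (hU : IsOpen U) (n : ℕ) {t : ℂ}
    (ht : t ∈ U) : ContinuousOn (fun s => Γ.integrand n t s) (Ioo 0 1) := by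
  intro s hs
  refine ContinuousAt.continuousWithinAt ?_
  refine (((Γ.hasDerivAt_path hU ht s).continuousAt.pow n).mul
    (Γ.hasDerivAt_weight_s hU ht hs).continuousAt).mul ?_
  exact ((Γ.continuousOn_deriv_path hU).continuousAt
    ((hU.prod isOpen_univ).mem_nhds ⟨ht, mem_univ _⟩)).comp (f := fun s => (t, s)) (by fun_prop)

theorem JacobiArc.exists_integrand_le (Γ : JacobiArc α β μ U) (hU : IsOpen U)
    (hU0 : (0 : ℂ) ∉ U) (hU1 : (1 : ℂ) ∉ U) (n : ℕ) {t₀ : ℂ} (ht : t₀ ∈ U) :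
    ∃ C, ∃ r > (0 : ℝ), Metric.closedBall t₀ r ⊆ U ∧ ∀ t ∈ Metric.closedBall t₀ r,
      ∀ s ∈ Ioo (0 : ℝ) 1, ‖Γ.integrand n t s‖ ≤ C * Γ.majorant s := by
  obtain ⟨C, hC, r, hr, hsub, h⟩ := Γ.exists_weight_le hU hU0 hU1 ht
  have hc : ContinuousOn (fun p : ℂ × ℝ => Γ.path p.1 p.2 ^ n * deriv (Γ.path p.1) p.2)
      (Metric.closedBall t₀ r ×ˢ Icc 0 1) :=
    ((Γ.contDiffOn_path.continuousOn.pow n).mul (Γ.continuousOn_deriv_path hU)).mono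
      (prod_mono hsub (subset_univ _))
  obtain ⟨M, hM⟩ := ((isCompact_closedBall t₀ r).prod isCompact_Icc).exists_bound_of_continuousOn hc
  refine ⟨M * C, r, hr, hsub, fun t htr s hs => ?_⟩
  have h1 := hM (t, s) ⟨htr, Ioo_subset_Icc_self hs⟩
  calc ‖Γ.integrand n t s‖
      = ‖Γ.path t s ^ n * deriv (Γ.path t) s‖ * ‖Γ.weight t s‖ := by
        rw [← norm_mul, JacobiArc.integrand]; ring_nf
    _ ≤ M * (C * Γ.majorant s) :=
        mul_le_mul h1 (h t htr s hs) (norm_nonneg _) ((norm_nonneg _).trans h1)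
    _ = M * C * Γ.majorant s := by ring

theorem JacobiArc.aestronglyMeasurable_integrand (Γ : JacobiArc α β μ U) (hU : IsOpen U) (n : ℕ)
    {t : ℂ} (ht : t ∈ U) :
    AEStronglyMeasurable (fun s => Γ.integrand n t s) (volume.restrict (Ioo 0 1)) :=
  (Γ.continuousOn_integrand hU n ht).aestronglyMeasurable measurableSet_Ioo

theorem JacobiArc.integrableOn_integrand (Γ : JacobiArc α β μ U) (hU : IsOpen U)
    (hU0 : (0 : ℂ) ∉ U) (hU1 : (1 : ℂ) ∉ U) (n : ℕ) {t : ℂ} (ht : t ∈ U) :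
    IntegrableOn (fun s => Γ.integrand n t s) (Ioo 0 1) := by
  obtain ⟨C, r, hr, _, h⟩ := Γ.exists_integrand_le hU hU0 hU1 n ht
  refine (Γ.integrableOn_majorant.const_mul C).mono' (Γ.aestronglyMeasurable_integrand hU n ht) ?_
  exact (ae_restrict_iff' measurableSet_Ioo).2
    (ae_of_all _ fun s hs => h t (Metric.mem_closedBall_self hr.le) s hs)

/-- The moments of an arc satisfy a first order differential-difference equation. -/
theorem JacobiArc.hasDerivAt_integral (Γ : JacobiArc α β μ U) (hU : IsOpen U)
    (hU0 : (0 : ℂ) ∉ U) (hU1 : (1 : ℂ) ∉ U) (n : ℕ) {t₀ : ℂ} (ht : t₀ ∈ U) :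
    ∃ D, HasDerivAt (fun t => ∫ s in (0 : ℝ)..1, Γ.integrand n t s) D t₀ ∧
      t₀ * (t₀ - 1) * D =
        (n + 2 + (α + β + μ)) * (∫ s in (0 : ℝ)..1, Γ.integrand (n + 1) t₀ s)
          + (-n + (μ * (t₀ - 1) - 1 - α)) * ∫ s in (0 : ℝ)..1, Γ.integrand n t₀ s := by
  obtain ⟨C, r, hr, hsub, h⟩ := Γ.exists_integrand_le hU hU0 hU1 n ht
  have hr2 : 0 < r / 2 := by positivity
  have hT : t₀ * (t₀ - 1) ≠ 0 :=
    mul_ne_zero (fun h => hU0 (h ▸ ht)) (sub_ne_zero.2 fun h => hU1 (h ▸ ht))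
  have hI : ∀ m, IntervalIntegrable (fun s => Γ.integrand m t₀ s) volume 0 1 := fun m => by
    rw [intervalIntegrable_iff_integrableOn_Ioo_of_le zero_le_one]
    exact Γ.integrableOn_integrand hU hU0 hU1 m ht
  set R : ℝ → ℂ := fun s => (n + 2 + (α + β + μ)) * Γ.integrand (n + 1) t₀ s
    + (-n + (μ * (t₀ - 1) - 1 - α)) * Γ.integrand n t₀ s with hR
  have hRI : IntervalIntegrable R volume 0 1 := ((hI (n + 1)).const_mul _).add ((hI n).const_mul _)
  -- Measurability in `s` of the `t`-derivative comes from the exact identity, which expresses it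
  -- through an `s`-derivative and integrands.
  have hmeas : AEStronglyMeasurable (fun s => deriv (fun t => Γ.integrand n t s) t₀)
      (volume.restrict (Ioo 0 1)) := by
    have h1 : AEStronglyMeasurable
        (fun s => (t₀ * (t₀ - 1))⁻¹ * (deriv (fun s => Γ.primitive n t₀ s) s + R s))
        (volume.restrict (Ioo 0 1)) := by
      refine AEStronglyMeasurable.const_mul ((aestronglyMeasurable_deriv _ _).add ?_) _
      exact (((Γ.aestronglyMeasurable_integrand hU (n + 1) ht).const_mul _).add
        ((Γ.aestronglyMeasurable_integrand hU n ht).const_mul _))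
    refine h1.congr ((ae_restrict_iff' measurableSet_Ioo).2 (ae_of_all _ fun s hs => ?_))
    dsimp only
    rw [(Γ.hasDerivAt_primitive hU n ht hs).deriv, hR, sub_add_cancel, inv_mul_cancel_left₀ hT]
  have key := hasDerivAt_integral_of_dominated_loc_of_deriv_le
    (μ := volume.restrict (Ioo (0 : ℝ) 1)) (F := fun t s => Γ.integrand n t s)
    (F' := fun t s => deriv (fun t => Γ.integrand n t s) t) (x₀ := t₀)
    (s := Metric.ball t₀ (r / 2)) (bound := fun s => C * Γ.majorant s / (r / 2))
    (Metric.ball_mem_nhds t₀ hr2)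
    (by filter_upwards [hU.mem_nhds ht] with t ht' using Γ.aestronglyMeasurable_integrand hU n ht')
    (Γ.integrableOn_integrand hU hU0 hU1 n ht) hmeas
    ((ae_restrict_iff' measurableSet_Ioo).2 (ae_of_all _ fun s hs t htb => by
      have hcb : Metric.closedBall t (r / 2) ⊆ Metric.closedBall t₀ r :=
        Metric.closedBall_subset_closedBall' (by have := Metric.mem_ball.1 htb; linarith)
      -- Cauchy's estimate on a circle of radius `r / 2` bounds the derivative by the majorant of
      -- the integrand, so the stronger end-point singularity of the differentiated weight never has
      -- to be estimated.
      refine Complex.norm_deriv_le_of_forall_mem_sphere_norm_le hr2 ?_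
        fun z hz => h z (hcb (Metric.sphere_subset_closedBall hz)) s hs
      refine DifferentiableOn.diffContOnCl_ball (U := U) (fun z hz => ?_) (hcb.trans hsub)
      exact (Γ.differentiableAt_integrand hU n hz hs).differentiableWithinAt))
    ((Γ.integrableOn_majorant.const_mul C).div_const _)
    ((ae_restrict_iff' measurableSet_Ioo).2 (ae_of_all _ fun s hs t htb =>
      (Γ.differentiableAt_integrand hU n (hsub (Metric.closedBall_subset_closedBall (by linarith)
        (Metric.ball_subset_closedBall htb))) hs).hasDerivAt))
  have hconv : ∀ f : ℝ → ℂ, ∫ s in (0 : ℝ)..1, f s = ∫ s in Ioo (0 : ℝ) 1, f s := fun f => by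
    rw [intervalIntegral.integral_of_le zero_le_one, integral_Ioc_eq_integral_Ioo]
  obtain ⟨hint, hder⟩ := key
  have hDI : IntervalIntegrable (fun s => deriv (fun t => Γ.integrand n t s) t₀) volume 0 1 := by
    rw [intervalIntegrable_iff_integrableOn_Ioo_of_le zero_le_one]
    exact hint
  refine ⟨∫ s in (0 : ℝ)..1, deriv (fun t => Γ.integrand n t s) t₀, ?_, ?_⟩
  · simp only [hconv]
    exact hder
  · have hftc := intervalIntegral.integral_eq_sub_of_hasDerivAt_of_tendsto zero_lt_one
      (fun s hs => Γ.hasDerivAt_primitive hU n ht hs) ((hDI.const_mul _).sub hRI)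
      (Γ.tendsto_primitive_zero hU hU0 hU1 n ht) (Γ.tendsto_primitive_one hU hU0 hU1 n ht)
    rw [intervalIntegral.integral_sub (hDI.const_mul _) hRI, hR,
      intervalIntegral.integral_add ((hI (n + 1)).const_mul _) ((hI n).const_mul _)] at hftc
    simp only [intervalIntegral.integral_const_mul, sub_zero] at hftc
    exact sub_eq_zero.1 hftc

theorem exists_hasDerivAt_jacobiMoment {ι : Type*} [Fintype ι] (Γ : ι → JacobiArc α β μ U)
    (hU : IsOpen U) (hU0 : (0 : ℂ) ∉ U) (hU1 : (1 : ℂ) ∉ U) {t : ℂ} (ht : t ∈ U) :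
    ∃ w' : ℕ → ℂ, (∀ n, HasDerivAt (fun s => jacobiMoment Γ s n) (w' n) t) ∧
      MomentFlow (α + β + μ) (μ * (t - 1) - 1 - α) (t * (t - 1)) (jacobiMoment Γ t) w' := by
  choose D hD hfl using fun n i => (Γ i).hasDerivAt_integral hU hU0 hU1 n ht
  refine ⟨fun n => ∑ i, D n i, fun n => HasDerivAt.fun_sum fun i _ => hD n i, fun n => ?_⟩
  simp only [jacobiMoment, Finset.mul_sum, ← Finset.sum_add_distrib]
  exact Finset.sum_congr rfl fun i _ => hfl n i

end LaguerreHahn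
end

theorem theorem6 {α β μ : ℂ} {U : Set ℂ} (hUo : IsOpen U) (hU0 : (0 : ℂ) ∉ U) (hU1 : (1 : ℂ) ∉ U)
    {ι : Type*} [Fintype ι] (Γ : ι → LaguerreHahn.JacobiArc α β μ U)
    (t : ℂ) (ht : t ∈ U)
    (hreg : ∀ k : ℕ, LaguerreHahn.hankelDet (LaguerreHahn.jacobiMoment Γ t) k ≠ 0)
    (n : ℕ) (hn : 1 ≤ n) :
    (DifferentiableAt ℂ (LaguerreHahn.betaTilde Γ n) t ∧
      t * (t - 1) * deriv (LaguerreHahn.betaTilde Γ n) t =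
        LaguerreHahn.betaTilde Γ n t * (LaguerreHahn.betaTilde Γ n t - 1)
          + (LaguerreHahn.nu α β μ (n - 1) + 2) * LaguerreHahn.gammaTilde Γ (n + 1) t
          - (LaguerreHahn.nu α β μ (n - 1) - 2) * LaguerreHahn.gammaTilde Γ n t) ∧
    (LaguerreHahn.gammaTilde Γ n t ≠ 0 ∧
      DifferentiableAt ℂ (LaguerreHahn.gammaTilde Γ n) t ∧
      t * (t - 1) * logDeriv (LaguerreHahn.gammaTilde Γ n) t =
        -2 + (LaguerreHahn.nu α β μ (n - 1) + 1) * LaguerreHahn.betaTilde Γ n t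
          - (LaguerreHahn.nu α β μ (n - 1) - 3) * LaguerreHahn.betaTilde Γ (n - 1) t) := by
  obtain ⟨k, rfl⟩ : ∃ k, n = k + 1 := ⟨n - 1, by omega⟩
  obtain ⟨w', hw, hfl⟩ := LaguerreHahn.exists_hasDerivAt_jacobiMoment Γ hUo hU0 hU1 ht
  have h0 := LaguerreHahn.recH_ne_zero_of_hankelDet_ne_zero hreg
  have hev := LaguerreHahn.eventually_recH_ne_zero hw h0 (k + 2)
  -- The functions to be differentiated must be identified near `t`, where finitely many norms stay
  -- nonzero; the neighbouring indices are needed at `t` alone.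
  have hβ : LaguerreHahn.betaTilde Γ (k + 1) =ᶠ[nhds t] fun s =>
      LaguerreHahn.recSub (LaguerreHahn.jacobiMoment Γ s) (k + 2)
        - LaguerreHahn.recSub (LaguerreHahn.jacobiMoment Γ s) (k + 3) := by
    filter_upwards [hev] with s hs using LaguerreHahn.recBeta_momentTilde hs
  have hγ : LaguerreHahn.gammaTilde Γ (k + 1) =ᶠ[nhds t] fun s =>
      LaguerreHahn.recH (LaguerreHahn.jacobiMoment Γ s) (k + 2)
        / LaguerreHahn.recH (LaguerreHahn.jacobiMoment Γ s) (k + 1) := by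
    filter_upwards [hev] with s hs using LaguerreHahn.recGamma_momentTilde hs
  have hβ' : LaguerreHahn.betaTilde Γ k t =
      LaguerreHahn.recSub (LaguerreHahn.jacobiMoment Γ t) (k + 1)
        - LaguerreHahn.recSub (LaguerreHahn.jacobiMoment Γ t) (k + 2) :=
    LaguerreHahn.recBeta_momentTilde fun i _ => h0 i
  have hγ' : LaguerreHahn.gammaTilde Γ (k + 1 + 1) t =
      LaguerreHahn.recH (LaguerreHahn.jacobiMoment Γ t) (k + 3)
        / LaguerreHahn.recH (LaguerreHahn.jacobiMoment Γ t) (k + 2) :=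
    LaguerreHahn.recGamma_momentTilde fun i _ => h0 i
  obtain ⟨B, hB, eB⟩ := LaguerreHahn.hasDerivAt_recSub_sub hw hfl h0 k rfl
  obtain ⟨G, hG, eG⟩ := LaguerreHahn.hasDerivAt_recH_div hw hfl h0 k
  have hB' := hB.congr_of_eventuallyEq hβ
  have hG' := hG.congr_of_eventuallyEq hγ
  refine ⟨⟨hB'.differentiableAt, ?_⟩, ?_, hG'.differentiableAt, ?_⟩
  · rw [hB'.deriv, eB, hβ.self_of_nhds, hγ.self_of_nhds, hγ', Nat.add_sub_cancel, LaguerreHahn.nu]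
    ring
  · rw [hγ.self_of_nhds]
    exact div_ne_zero (h0 _) (h0 _)
  · rw [logDeriv_apply, hG'.deriv, hγ.self_of_nhds, eG, hβ.self_of_nhds, Nat.add_sub_cancel, hβ',
      LaguerreHahn.nu]
    ring
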